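/- Let $n\ge 1$, $\alpha\in\mathbb R$ and $1<p<\infty$. Let $D=C_0^\infty(\mathbb R^n)$ (complex-valued), let $D'$ be the space of distributions on $D$, and let $H_p^s=H_p^s(\mathbb R^n)$ ($s\in\mathbb R$) be the Bessel potential spaces with norms $\|\cdot\|_{s,p}$. Put $H_{p,\mathrm{loc}}^{s}=\{v\in D' : v\phi\in H_p^{s}\ \ \forall\phi\in D\}$. The space $M_p^\alpha$ of multipliers from $H_p^\alpha$ to $H_p^{-\alpha}$ consists of all $\mu\in H_{p,\mathrm{loc}}^{-\alpha}$ for which there is a constant $C$ with $$\|\mu\phi\|_{-\alpha,p}\le C\|\phi\|_{\alpha,p}\qquad\text{for all }\phi\in D,$$ and $\|\mu\|_{M_p^\alpha}$ is the infimum of all such constants $C$. Fix a function $\eta\in D$ with $\eta\ge 0$ and $\eta(x)=1$ for $|x|\le 1$. Then, for every $\mu\in M_p^\alpha$, all products $\eta(\cdot-z)\mu$ $(z\in\mathbb R^n)$ belong to $M_p^\alpha$, the quantity $$|||\mu|||_{M_p^\alpha}=\sup_{z\in\mathbb R^n}\|\eta(\cdot-z)\mu\|_{M_p^\alpha}$$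 is finite, and the norms $|||\cdot|||_{M_p^\alpha}$ and $\|\cdot\|_{M_p^\alpha}$ on $M_p^\alpha$ are equivalent: there is a constant $C>0$, depending only on $n$, $p$, $\alpha$ and $\eta$, such that for all $\mu\in M_p^\alpha$ $$|||\mu|||_{M_p^\alpha}\le C\,\|\mu\|_{M_p^\alpha}\qquad\text{and}\qquad \|\mu\|_{M_p^\alpha}\le C\,|||\mu|||_{M_p^\alpha}.$$ -/

import Mathlib

open MeasureTheory TopologicalSpace
open scoped ENNReal NNReal Distributions SchwartzMap

noncomputable section

namespace SobolevMultiplier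

/-- The space `ℝⁿ` with its Euclidean norm and Lebesgue measure. -/
abbrev Space (n : ℕ) : Type := EuclideanSpace ℝ (Fin n)

/-- The space `D` of complex-valued smooth compactly supported functions on `ℝⁿ`,
with its usual (inductive limit) topology. -/
abbrev TestFn (n : ℕ) : Type := 𝓓((⊤ : Opens (Space n)), ℂ)

/-- The space `D'` of complex distributions on `ℝⁿ`: continuous `ℂ`-linear functionals on `D`. -/
abbrev Distr (n : ℕ) : Type := TestFn n →L[ℂ] ℂ

/-- A test function, viewed as a Schwartz function. -/
def TestFn.toSchwartz {n : ℕ} (φ : TestFn n) : 𝓢(Space n, ℂ) :=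
  φ.hasCompactSupport.toSchwartzMap φ.contDiff

/-- The translated test function `x ↦ φ (x - z)`. -/
def TestFn.translate {n : ℕ} (z : Space n) (φ : TestFn n) : TestFn n where
  toFun x := φ (x - z)
  contDiff' := φ.contDiff.comp (contDiff_id.sub contDiff_const)
  hasCompactSupport' :=
    φ.hasCompactSupport.comp_isClosedEmbedding (Homeomorph.subRight z).isClosedEmbedding
  tsupport_subset' := fun _ _ => trivial

/-- Multiplication by a fixed test function `φ`, as a continuous linear map `D → D`. -/
def TestFn.mulCLM {n : ℕ} (φ : TestFn n) : TestFn n →L[ℂ] TestFn n :=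
  TestFunction.limitCLM ℂ
    (fun ψ =>
      { toFun := fun x => ψ x * φ x
        contDiff' := ψ.contDiff.mul φ.contDiff
        hasCompactSupport' := ψ.hasCompactSupport.mul_right
        tsupport_subset' := fun _ _ => trivial })
    (fun _K hK => (TestFunction.ofSupportedInCLM ℂ hK).comp
      (ContDiffMapSupportedIn.bilinLeftCLM (ContinuousLinearMap.mul ℂ ℂ) φ.contDiff))
    (fun _ _ _ => rfl)

@[simp]
theorem TestFn.mulCLM_apply {n : ℕ} (φ ψ : TestFn n) (x : Space n) :
    φ.mulCLM ψ x = ψ x * φ x := rfl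

/-- The product `φ μ ∈ D'` of a distribution `μ` and a test function `φ`:
`(φ μ)(ψ) = μ (φ ψ)`. -/
def Distr.mul {n : ℕ} (φ : TestFn n) (μ : Distr n) : Distr n :=
  μ.comp φ.mulCLM

/-- The tempered distribution `T` restricts to the distribution `u` on `D`.  As `D` is dense in the
Schwartz space, there is at most one such `T`. -/
def IsRestriction {n : ℕ} (T : 𝓢'(Space n, ℂ)) (u : Distr n) : Prop :=
  ∀ ψ : TestFn n, T ψ.toSchwartz = u ψ

/-- The norm `‖T‖_{s,p}` of the Bessel potential space `H_p^s`, for a tempered distribution `T`: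
the `L_p` norm of the Bessel potential of order `s` of `T` (the element of `L_p` that represents
it is unique), and `∞` if that is not in `L_p`. -/
def temperedSobolevNorm {n : ℕ} (s : ℝ) (p : ℝ≥0∞) [Fact (1 ≤ p)] (T : 𝓢'(Space n, ℂ)) : ℝ≥0∞ :=
  ⨅ (f : Lp ℂ p (volume : Measure (Space n)))
    (_ : TemperedDistribution.besselPotential (Space n) ℂ s T = f), ‖f‖ₑ

/-- The norm `‖u‖_{s,p}` for a distribution `u ∈ D'`, equal to `∞` if `u ∉ H_p^s`. -/
def sobolevNorm {n : ℕ} (s : ℝ) (p : ℝ≥0∞) [Fact (1 ≤ p)] (u : Distr n) : ℝ≥0∞ :=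
  ⨅ (T : 𝓢'(Space n, ℂ)) (_ : IsRestriction T u), temperedSobolevNorm s p T

/-- The norm `‖φ‖_{s,p}` of a test function `φ ∈ D`. -/
def TestFn.sobolevNorm {n : ℕ} (s : ℝ) (p : ℝ≥0∞) [Fact (1 ≤ p)] (φ : TestFn n) : ℝ≥0∞ :=
  temperedSobolevNorm s p (φ.toSchwartz : 𝓢'(Space n, ℂ))

/-- `u ∈ H_p^s`, for a distribution `u ∈ D'`. -/
def MemSobolev {n : ℕ} (s : ℝ) (p : ℝ≥0∞) [Fact (1 ≤ p)] (u : Distr n) : Prop :=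
  ∃ T : 𝓢'(Space n, ℂ), IsRestriction T u ∧ TemperedDistribution.MemSobolev s p T

/-- `u ∈ H_{p,loc}^s`: `φ u ∈ H_p^s` for all `φ ∈ D`. -/
def MemSobolevLoc {n : ℕ} (s : ℝ) (p : ℝ≥0∞) [Fact (1 ≤ p)] (u : Distr n) : Prop :=
  ∀ φ : TestFn n, MemSobolev s p (u.mul φ)

/-- The multiplier inequality `‖μ φ‖_{-α,p} ≤ C ‖φ‖_{α,p}` for all `φ ∈ D`. -/
def MultiplierBound {n : ℕ} (α : ℝ) (p : ℝ≥0∞) [Fact (1 ≤ p)] (μ : Distr n) (C : ℝ≥0) : Prop :=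
  ∀ φ : TestFn n, sobolevNorm (-α) p (μ.mul φ) ≤ C * φ.sobolevNorm α p

/-- The space `M_p^α` of multipliers from `H_p^α` to `H_p^{-α}`. -/
def multiplierSpace (n : ℕ) (α : ℝ) (p : ℝ≥0∞) [Fact (1 ≤ p)] : Set (Distr n) :=
  {μ | MemSobolevLoc (-α) p μ ∧ ∃ C : ℝ≥0, MultiplierBound α p μ C}

/-- The multiplier norm `‖μ‖_{M_p^α}`: the infimum of the constants `C` in the multiplier
inequality (`∞` if there are none). -/
def multiplierNorm {n : ℕ} (α : ℝ) (p : ℝ≥0∞) [Fact (1 ≤ p)] (μ : Distr n) : ℝ≥0∞ :=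
  ⨅ (C : ℝ≥0) (_ : MultiplierBound α p μ C), (C : ℝ≥0∞)

/-- The uniformly localized norm `|||μ||| = sup_z ‖η(· - z) μ‖_{M_p^α}`. -/
def localizedNorm {n : ℕ} (η : TestFn n) (α : ℝ) (p : ℝ≥0∞) [Fact (1 ≤ p)] (μ : Distr n) : ℝ≥0∞ :=
  ⨆ z : Space n, multiplierNorm α p (μ.mul (η.translate z))

end SobolevMultiplier

end

/-!
A uniform bound for the localized multipliers `η(· - z) μ` follows from two facts, both statements
about the Bessel potential `J = (1 - (2π)⁻² Δ) ^ (1/2)` on Schwartz functions.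

*Multiplication is uniformly bounded.*  For `1 ≤ p < ∞`, every real `a`, and a family of Schwartz
functions `ζ` whose derivatives are bounded uniformly over the family,
`‖J ^ a (ζ J ^ (-a) g)‖_p ≤ C ‖g‖_p` with `C` common to the family (`besselStable`).  The functions
`ζ` may take values in arbitrary Banach spaces.  The orders `a` are reached from `[0, 2)` by steps
of `± 2` with the product rule.  For `a = 2 θ ∈ (0, 2)` the operator `J ^ a` is a superposition of
`t ^ θ (t⁻¹ - R_t)`, where `R_t = (t + J ^ 2)⁻¹`, and the commutator `[ζ, R_t] = R_t [J ^ 2, ζ] R_t`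
is of lower order, so that `[ζ, R_t] J ^ (-a)` decays fast enough in `t`
(`exists_commutator_bound`).
All the multiplier bounds needed are of `L¹` type: the symbols are superpositions of Gaussians and
of linear functions times Gaussians, to which Minkowski's inequality applies.  No singular integrals
occur, and the bounds hold for vector-valued functions.

*Square functions.*  Applied to `ζ = (χ(· - z))_z` with values in finite dimensional `ℓ^p` spaces,
`z` running through finite sets of lattice points, the first fact gives
`∑_z ‖J ^ a (χ(· - z) f)‖_p ^ p ≤ C ‖J ^ a f‖_p ^ p` (`exists_sum_bessel_translate_le`).  Applied to
single translates it bounds the localized norm by the multiplier norm.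

For the converse, choose a partition of unity `(ψ_z)_z` by lattice translates with supports in unit
balls.  As `η(· - z) = 1` on the support of `ψ_z`, writing `η_z` for `η(· - z)`,
`(φ μ)(h) = ∑_z (η_z μ · η_z φ)(ψ_z h)`.  Each summand is at most
`‖η_z μ‖_M ‖η_z φ‖_{a,p} ‖ψ_z h‖_{a,q}`, with `q` the exponent conjugate to `p`, and Hölder's
inequality in `z` and the square function estimates for `(p, η)` and `(q, ψ)` bound the sum by
`C sup_z ‖η_z μ‖_M ‖φ‖_{a,p} ‖h‖_{a,q}`.  Since `H_p^{-a}` is normed by its pairing with test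
functions in `H_q^a` (`sobolevNorm_le_of_forall_enorm_apply_le`), this is the multiplier inequality
for `μ`.
-/

noncomputable section

namespace SobolevMultiplier

open FourierTransform Function

/-! ### Minkowski's integral inequality and superpositions of Fourier multipliers -/

/-- Minkowski's integral inequality for a function that is already known to lie in `L_p`: that
knowledge allows one to divide by `‖u‖_p ^ (p - 1)`, so no duality of `L_p` spaces is needed. -/
theorem eLpNorm_le_lintegral_eLpNorm {X Ω F : Type*} [MeasurableSpace X] [MeasurableSpace Ω]
    {μ : Measure X} {ν : Measure Ω} [SFinite μ] [SFinite ν] [NormedAddCommGroup F] {p : ℝ≥0∞}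
    (hp1 : 1 ≤ p) (hp : p ≠ ⊤) {u : X → F} (hu : MemLp u p μ) {H : Ω → X → ℝ≥0∞}
    (hH : Measurable (uncurry H)) (h : ∀ x, ‖u x‖ₑ ≤ ∫⁻ ω, H ω x ∂ν) :
    eLpNorm u p μ ≤ ∫⁻ ω, eLpNorm (H ω) p μ ∂ν := by
  have hp0 : p ≠ 0 := (zero_lt_one.trans_le hp1).ne'
  set P := p.toReal with hP
  have hP1 : 1 ≤ P := by
    rw [hP, ← ENNReal.toReal_one]; exact ENNReal.toReal_mono hp hp1
  have hP0 : 0 < P := zero_lt_one.trans_le hP1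
  by_cases hN : eLpNorm u p μ = 0
  · simp [hN]
  have hNtop : eLpNorm u p μ ≠ ⊤ := hu.2.ne
  have hNP : eLpNorm u p μ ^ P = ∫⁻ x, ‖u x‖ₑ ^ P ∂μ := by
    rw [eLpNorm_eq_lintegral_rpow_enorm_toReal hp0 hp, ← ENNReal.rpow_mul,
      one_div_mul_cancel hP0.ne', ENNReal.rpow_one]
  have hum : AEMeasurable (fun x => ‖u x‖ₑ) μ := hu.1.enorm
  -- one factor `‖u x‖` is replaced by the integral of `H`, and Hölder's inequality in `x` is
  -- applied with the exponents `P / (P - 1)` and `P`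
  have key : eLpNorm u p μ ^ P ≤ eLpNorm u p μ ^ (P - 1) * ∫⁻ ω, eLpNorm (H ω) p μ ∂ν := by
    calc eLpNorm u p μ ^ P = ∫⁻ x, ‖u x‖ₑ ^ (P - 1) * ‖u x‖ₑ ∂μ := by
          rw [hNP]
          refine lintegral_congr fun x => ?_
          conv_lhs => rw [show P = (P - 1) + 1 by ring]
          rw [ENNReal.rpow_add_of_nonneg _ _ (by linarith) zero_le_one, ENNReal.rpow_one]
      _ ≤ ∫⁻ x, ‖u x‖ₑ ^ (P - 1) * ∫⁻ ω, H ω x ∂ν ∂μ :=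
          lintegral_mono fun x => mul_le_mul_right (h x) _
      _ = ∫⁻ x, ∫⁻ ω, ‖u x‖ₑ ^ (P - 1) * H ω x ∂ν ∂μ := by
          refine lintegral_congr fun x => ?_
          rw [lintegral_const_mul]
          exact hH.comp measurable_prodMk_right
      _ = ∫⁻ ω, ∫⁻ x, ‖u x‖ₑ ^ (P - 1) * H ω x ∂μ ∂ν := by
          refine lintegral_lintegral_swap ?_
          refine AEMeasurable.mul ((hum.pow_const _).comp_fst) ?_
          exact (hH.comp measurable_swap).aemeasurable
      _ ≤ ∫⁻ ω, eLpNorm u p μ ^ (P - 1) * eLpNorm (H ω) p μ ∂ν := by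
          refine lintegral_mono fun ω => ?_
          have hHω : AEMeasurable (H ω) μ := (hH.comp measurable_prodMk_left).aemeasurable
          have := ENNReal.lintegral_mul_norm_pow_le (μ := μ) (hum.pow_const P) (hHω.pow_const P)
            (p := (P - 1) / P) (q := 1 / P) (by apply div_nonneg <;> linarith) (by positivity)
            (by field_simp; ring)
          rw [← hNP, ← ENNReal.rpow_mul, mul_div_cancel₀ _ hP0.ne'] at this
          rw [eLpNorm_eq_lintegral_rpow_enorm_toReal hp0 hp (f := H ω)]
          refine le_trans (le_of_eq (lintegral_congr fun x => ?_)) this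
          rw [← ENNReal.rpow_mul, ← ENNReal.rpow_mul, mul_div_cancel₀ _ hP0.ne',
            mul_one_div_cancel hP0.ne', ENNReal.rpow_one]
      _ = _ := lintegral_const_mul' _ _ (ENNReal.rpow_ne_top_of_nonneg (by linarith) hNtop)
  have e : eLpNorm u p μ ^ P = eLpNorm u p μ ^ (P - 1) * eLpNorm u p μ := by
    conv_lhs => rw [show P = (P - 1) + 1 by ring]
    rw [ENNReal.rpow_add_of_nonneg _ _ (by linarith) zero_le_one, ENNReal.rpow_one]
  rw [e] at key
  exact (ENNReal.mul_le_mul_iff_right (ENNReal.rpow_pos (pos_iff_ne_zero.2 hN) hNtop).ne'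
    (ENNReal.rpow_ne_top_of_nonneg (by linarith) hNtop)).1 key

variable {V : Type*} [NormedAddCommGroup V] [InnerProductSpace ℝ V] [FiniteDimensional ℝ V]
  [MeasurableSpace V] [BorelSpace V]

/-- The function `𝓕⁻ (m 𝓕 f)`, for a symbol `m` without any growth or smoothness condition.  It is
`SchwartzMap.fourierMultiplierCLM` if `m` has temperate growth. -/
def multiplierFun {F : Type*} [NormedAddCommGroup F] [NormedSpace ℂ F] (m : V → ℂ) (f : 𝓢(V, F)) :
    V → F :=
  𝓕⁻ (fun ξ => m ξ • 𝓕 f ξ)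

theorem multiplierFun_eq {F : Type*} [NormedAddCommGroup F] [NormedSpace ℂ F] {m : V → ℂ}
    (hm : m.HasTemperateGrowth) (f : 𝓢(V, F)) :
    multiplierFun m f = SchwartzMap.fourierMultiplierCLM F m f := by
  rw [SchwartzMap.fourierMultiplierCLM_apply, SchwartzMap.fourierInv_coe,
    SchwartzMap.smulLeftCLM_apply hm]
  rfl

/-- Joint integrability for Fubini's theorem: the polynomial growth of the mass of the symbols is
absorbed by the decay of `𝓕 f`. -/
theorem integrable_fourierChar_smul_smul {Ω F : Type*} [MeasurableSpace Ω] {ν : Measure Ω}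
    [SFinite ν] [NormedAddCommGroup F] [NormedSpace ℂ F] {m : Ω → V → ℂ}
    (hm : Measurable (uncurry m)) (f : 𝓢(V, F)) {K : ℝ} {N : ℕ}
    (hK : ∀ ξ, ∫⁻ ω, ‖m ω ξ‖ₑ ∂ν ≤ ENNReal.ofReal (K * (1 + ‖ξ‖) ^ N)) (x : V) :
    Integrable (uncurry fun (ξ : V) (ω : Ω) =>
      Real.fourierChar (inner ℝ ξ x) • m ω ξ • 𝓕 f ξ) (volume.prod ν) := by
  have hf : StronglyMeasurable (𝓕 f : 𝓢(V, F)) := (𝓕 f).continuous.stronglyMeasurable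
  have hmeas : StronglyMeasurable
      (uncurry fun (ξ : V) (ω : Ω) => Real.fourierChar (inner ℝ ξ x) • m ω ξ • 𝓕 f ξ) := by
    simp only [Circle.smul_def]
    refine StronglyMeasurable.smul ?_ (StronglyMeasurable.smul ?_ ?_)
    · have : Continuous fun ξ : V => ((Real.fourierChar (inner ℝ ξ x) : Circle) : ℂ) := by fun_prop
      exact this.stronglyMeasurable.comp_measurable measurable_fst
    · exact (hm.comp measurable_swap).stronglyMeasurable
    · exact hf.comp_measurable measurable_fst
  have hbig : Integrable (fun ξ : V => (K * (1 + ‖ξ‖) ^ N) * ‖𝓕 f ξ‖) := by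
    simp only [mul_assoc]
    refine Integrable.const_mul ?_ K
    have h1 : Integrable (fun ξ : V => ∑ k ∈ Finset.range (N + 1),
        (N.choose k : ℝ) * (‖ξ‖ ^ k * ‖𝓕 f ξ‖)) :=
      integrable_finsetSum _ fun k _ => ((𝓕 f).integrable_pow_mul volume k).const_mul _
    refine h1.congr (Filter.Eventually.of_forall fun ξ => ?_)
    simp only [add_comm (1 : ℝ), add_pow, one_pow, mul_one, Finset.sum_mul]
    exact Finset.sum_congr rfl fun k _ => by ring
  refine ⟨hmeas.aestronglyMeasurable, ?_⟩
  rw [hasFiniteIntegral_iff_enorm, lintegral_prod _ hmeas.enorm.aemeasurable]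
  refine lt_of_le_of_lt (lintegral_mono fun ξ => ?_) hbig.2
  have hchar (t : ℝ) : ‖((Real.fourierChar t : Circle) : ℂ)‖ₑ = 1 := by
    rw [← ofReal_norm, Circle.norm_coe, ENNReal.ofReal_one]
  simp only [uncurry_apply_pair, Circle.smul_def, enorm_smul, enorm_mul K, hchar, one_mul,
    enorm_mul _ ‖_‖, enorm_norm]
  rw [lintegral_mul_const' _ _ enorm_ne_top, ← enorm_mul]
  gcongr
  refine (hK ξ).trans ?_
  rw [← ofReal_norm]
  exact ENNReal.ofReal_le_ofReal (le_abs_self _)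

/-- A superposition of symbols gives a superposition of the operators. -/
theorem multiplierFun_integral {Ω F : Type*} [MeasurableSpace Ω] {ν : Measure Ω} [SFinite ν]
    [NormedAddCommGroup F] [NormedSpace ℂ F] [CompleteSpace F] {m : Ω → V → ℂ}
    (hm : Measurable (uncurry m)) (f : 𝓢(V, F)) {K : ℝ} {N : ℕ}
    (hK : ∀ ξ, ∫⁻ ω, ‖m ω ξ‖ₑ ∂ν ≤ ENNReal.ofReal (K * (1 + ‖ξ‖) ^ N)) (x : V) :
    multiplierFun (fun ξ => ∫ ω, m ω ξ ∂ν) f x = ∫ ω, multiplierFun (m ω) f x ∂ν := by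
  unfold multiplierFun
  simp only [Real.fourierInv_eq]
  rw [← integral_integral_swap (integrable_fourierChar_smul_smul hm f hK x)]
  refine integral_congr_ae (Filter.Eventually.of_forall fun ξ => ?_)
  simp only [Circle.smul_def]
  rw [integral_smul, integral_smul_const]

theorem integrable_multiplierFun {Ω F : Type*} [MeasurableSpace Ω] {ν : Measure Ω} [SFinite ν]
    [NormedAddCommGroup F] [NormedSpace ℂ F] {m : Ω → V → ℂ}
    (hm : Measurable (uncurry m)) (f : 𝓢(V, F)) {K : ℝ} {N : ℕ}
    (hK : ∀ ξ, ∫⁻ ω, ‖m ω ξ‖ₑ ∂ν ≤ ENNReal.ofReal (K * (1 + ‖ξ‖) ^ N)) (x : V) :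
    Integrable (fun ω => multiplierFun (m ω) f x) ν := by
  unfold multiplierFun
  simp only [Real.fourierInv_eq]
  exact (integrable_fourierChar_smul_smul hm f hK x).integral_prod_right

theorem stronglyMeasurable_multiplierFun {Ω F : Type*} [MeasurableSpace Ω]
    [NormedAddCommGroup F] [NormedSpace ℂ F] {m : Ω → V → ℂ} (hm : Measurable (uncurry m))
    (f : 𝓢(V, F)) : StronglyMeasurable (uncurry fun ω x => multiplierFun (m ω) f x) := by
  have hf : StronglyMeasurable (𝓕 f : 𝓢(V, F)) := (𝓕 f).continuous.stronglyMeasurable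
  unfold multiplierFun
  simp only [Real.fourierInv_eq]
  refine StronglyMeasurable.integral_prod_right (α := Ω × V) (β := V)
    (f := fun a ξ => Real.fourierChar (inner ℝ ξ a.2) • m a.1 ξ • 𝓕 f ξ) ?_
  simp only [Circle.smul_def]
  refine StronglyMeasurable.smul ?_ (StronglyMeasurable.smul ?_ ?_)
  · have : Continuous fun q : V × V => ((Real.fourierChar (inner ℝ q.2 q.1) : Circle) : ℂ) := by
      fun_prop
    exact this.stronglyMeasurable.comp_measurable
      ((measurable_snd.comp measurable_fst).prodMk measurable_snd)
  · exact (hm.comp ((measurable_fst.comp measurable_fst).prodMk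
      measurable_snd)).stronglyMeasurable
  · exact hf.comp_measurable measurable_snd

/-- The Fourier multiplier with symbol `m` maps `L_p` to `L_p` with norm at most `C`, tested on
Schwartz functions with values in an arbitrary Banach space. -/
def LpMultiplierBound (p : ℝ≥0∞) (m : V → ℂ) (C : ℝ≥0∞) : Prop :=
  ∀ (F : Type) [NormedAddCommGroup F] [NormedSpace ℂ F] [CompleteSpace F] (f : 𝓢(V, F)),
    eLpNorm (multiplierFun m f) p volume ≤ C * eLpNorm f p volume

theorem LpMultiplierBound.mono {p : ℝ≥0∞} {m : V → ℂ} {C D : ℝ≥0∞} (h : LpMultiplierBound p m C)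
    (hCD : C ≤ D) : LpMultiplierBound p m D :=
  fun F _ _ _ f => (h F f).trans (by gcongr)

/-- The `L_p` bound of a superposition of symbols is at most the integral of the bounds, by
Minkowski's inequality. -/
theorem LpMultiplierBound.superposition {Ω : Type*} [MeasurableSpace Ω] {ν : Measure Ω} [SFinite ν]
    {p : ℝ≥0∞} (hp1 : 1 ≤ p) (hp : p ≠ ⊤) {m : Ω → V → ℂ} (hm : Measurable (uncurry m))
    {M : V → ℂ} (hM : M.HasTemperateGrowth) (hMm : ∀ ξ, M ξ = ∫ ω, m ω ξ ∂ν) {K : ℝ} {N : ℕ}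
    (hK : ∀ ξ, ∫⁻ ω, ‖m ω ξ‖ₑ ∂ν ≤ ENNReal.ofReal (K * (1 + ‖ξ‖) ^ N)) {C : Ω → ℝ≥0∞}
    (hC : ∀ᵐ ω ∂ν, LpMultiplierBound p (m ω) (C ω)) :
    LpMultiplierBound p M (∫⁻ ω, C ω ∂ν) := by
  intro F _ _ _ f
  have hu : MemLp (multiplierFun M f) p volume := by
    rw [multiplierFun_eq hM]
    exact SchwartzMap.memLp _ _ _
  have hs := stronglyMeasurable_multiplierFun hm f
  refine (eLpNorm_le_lintegral_eLpNorm (ν := ν) hp1 hp hu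
    (H := fun ω x => ‖multiplierFun (m ω) f x‖ₑ) hs.enorm fun x => ?_).trans ?_
  · rw [funext hMm, multiplierFun_integral hm f hK]
    exact enorm_integral_le_lintegral_enorm _
  · rw [← lintegral_mul_const' _ _ (f.eLpNorm_lt_top p volume).ne]
    refine lintegral_mono_ae ?_
    filter_upwards [hC] with ω hω
    rw [eLpNorm_enorm]
    exact hω F f

end SobolevMultiplier

namespace SobolevMultiplier

open FourierTransform Function

/-! ### Symbols dominated by Gaussians -/

theorem pow_mul_exp_neg_sq_bounded (k : ℕ) :
    ∃ C : ℝ, ∀ r : ℝ, 0 ≤ r → (1 + r) ^ k * Real.exp (-r ^ 2) ≤ C := by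
  refine ⟨Real.exp 1 * k.factorial * Real.exp 1, fun r hr => ?_⟩
  have h1 : (1 + r) ^ k / k.factorial ≤ Real.exp (1 + r) :=
    Real.pow_div_factorial_le_exp _ (by linarith) k
  have hk : (0 : ℝ) < k.factorial := by exact_mod_cast k.factorial_pos
  rw [div_le_iff₀ hk] at h1
  calc (1 + r) ^ k * Real.exp (-r ^ 2) ≤ Real.exp (1 + r) * k.factorial * Real.exp (-r ^ 2) := by
        gcongr
    _ = Real.exp 1 * k.factorial * Real.exp (r - r ^ 2) := by
        rw [Real.exp_add, Real.exp_sub, Real.exp_neg]; ring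
    _ ≤ _ := by
        gcongr
        nlinarith [sq_nonneg (r - 1)]

/-- The Gaussian `x ↦ exp (-‖x‖²)` as a Schwartz function. -/
def gaussianSchwartz (V : Type*) [NormedAddCommGroup V] [InnerProductSpace ℝ V] : 𝓢(V, ℂ) where
  toFun x := (Real.exp (-‖x‖ ^ 2) : ℝ)
  smooth' := by
    have : ContDiff ℝ (⊤ : ℕ∞) fun x : V => Real.exp (-‖x‖ ^ 2) :=
      Real.contDiff_exp.comp (contDiff_norm_sq ℝ).neg
    exact Complex.ofRealCLM.contDiff.comp this
  decay' := by
    intro k n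
    have hq : Function.HasTemperateGrowth fun x : V => -‖x‖ ^ 2 := by fun_prop
    obtain ⟨N, C, hC, hb⟩ := hq.norm_iteratedFDeriv_le_uniform n
    obtain ⟨B, hB⟩ := pow_mul_exp_neg_sq_bounded (k + N * n)
    refine ⟨n.factorial * (1 + C) ^ n * B, fun x => ?_⟩
    have hexp : ∀ i ≤ n, ‖iteratedFDeriv ℝ i (fun t : ℝ => (Real.exp t : ℂ)) (-‖x‖ ^ 2)‖
        ≤ Real.exp (-‖x‖ ^ 2) := by
      intro i _
      have h1 := Complex.ofRealCLM.norm_iteratedFDeriv_comp_left (n := i) (x := -‖x‖ ^ 2)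
        (f := Real.exp)
        Real.contDiff_exp.contDiffAt (mod_cast le_top)
      refine h1.trans ?_
      rw [Complex.ofRealCLM_norm, one_mul, norm_iteratedFDeriv_eq_norm_iteratedDeriv,
        iteratedDeriv_eq_iterate, Real.iter_deriv_exp, Real.norm_of_nonneg (Real.exp_nonneg _)]
    have hD : ∀ i, 1 ≤ i → i ≤ n →
        ‖iteratedFDeriv ℝ i (fun x : V => -‖x‖ ^ 2) x‖ ≤ ((1 + C) * (1 + ‖x‖) ^ N) ^ i := by
      intro i hi hin
      have h1 : 1 ≤ (1 + C) * (1 + ‖x‖) ^ N :=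
        one_le_mul_of_one_le_of_one_le (by linarith) (one_le_pow₀ (by linarith [norm_nonneg x]))
      refine (hb i hin x).trans (le_trans ?_ (le_self_pow₀ h1 (by omega)))
      gcongr
      linarith
    have hcd : ContDiff ℝ (⊤ : ℕ∞) fun t : ℝ => (Real.exp t : ℂ) :=
      Complex.ofRealCLM.contDiff.comp Real.contDiff_exp
    have := norm_iteratedFDeriv_comp_le (n := n) hcd hq.1 (mod_cast le_top) x hexp hD
    calc ‖x‖ ^ k * ‖iteratedFDeriv ℝ n (fun x : V => ((Real.exp (-‖x‖ ^ 2) : ℝ) : ℂ)) x‖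
        ≤ (1 + ‖x‖) ^ k * (n.factorial * Real.exp (-‖x‖ ^ 2) *
          ((1 + C) * (1 + ‖x‖) ^ N) ^ n) := by
          gcongr
          · linarith
          · exact this
      _ = n.factorial * (1 + C) ^ n * ((1 + ‖x‖) ^ (k + N * n) * Real.exp (-‖x‖ ^ 2)) := by
          rw [mul_pow, ← pow_mul, pow_add]; ring
      _ ≤ _ := by
          gcongr
          exact hB _ (norm_nonneg x)

section

variable {V : Type*} [NormedAddCommGroup V] [InnerProductSpace ℝ V]

theorem gaussianSchwartz_apply (x : V) :
    gaussianSchwartz V x = (Real.exp (-‖x‖ ^ 2) : ℝ) := rfl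

theorem hasTemperateGrowth_exp_neg_mul_norm_sq {ρ : ℝ} (hρ : 0 < ρ) :
    Function.HasTemperateGrowth fun ξ : V => ((Real.exp (-(ρ * ‖ξ‖ ^ 2)) : ℝ) : ℂ) := by
  have hc : Function.HasTemperateGrowth fun ξ : V => Real.sqrt ρ • ξ :=
    (Real.sqrt ρ • ContinuousLinearMap.id ℝ V).hasTemperateGrowth
  have h1 := (gaussianSchwartz V).hasTemperateGrowth.comp hc
  convert h1 using 2 with ξ
  simp only [Function.comp_apply, gaussianSchwartz_apply, norm_smul, mul_pow, Real.norm_eq_abs,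
    sq_abs, Real.sq_sqrt hρ.le]

theorem hasTemperateGrowth_add_norm_sq_rpow {l : ℝ} (hl : 0 < l) (s : ℝ) :
    Function.HasTemperateGrowth fun ξ : V => (((l + ‖ξ‖ ^ 2) ^ s : ℝ) : ℂ) := by
  have hc : Function.HasTemperateGrowth fun ξ : V => (Real.sqrt l)⁻¹ • ξ :=
    ((Real.sqrt l)⁻¹ • ContinuousLinearMap.id ℝ V).hasTemperateGrowth
  have h1 := (Function.hasTemperateGrowth_one_add_norm_sq_rpow V s).comp hc
  have h2 : Function.HasTemperateGrowth fun ξ : V =>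
      l ^ s * ((1 + ‖(Real.sqrt l)⁻¹ • ξ‖ ^ 2) ^ s) := (HasTemperateGrowth.const _).mul h1
  have h3 : (fun ξ : V => l ^ s * ((1 + ‖(Real.sqrt l)⁻¹ • ξ‖ ^ 2) ^ s)) =
      fun ξ : V => (l + ‖ξ‖ ^ 2) ^ s := by
    ext ξ
    rw [← Real.mul_rpow hl.le (by positivity), norm_smul, mul_pow, norm_inv, inv_pow,
      Real.norm_eq_abs, sq_abs, Real.sq_sqrt hl.le]
    congr 1
    field_simp
  rw [h3] at h2
  exact Complex.hasTemperateGrowth_ofReal.comp h2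

end

variable {V : Type*} [NormedAddCommGroup V] [InnerProductSpace ℝ V] [FiniteDimensional ℝ V]
  [MeasurableSpace V] [BorelSpace V]

theorem LpMultiplierBound.const_mul {p : ℝ≥0∞} {m : V → ℂ} {C : ℝ≥0∞} (c : ℂ)
    (h : LpMultiplierBound p m C) : LpMultiplierBound p (fun ξ => c * m ξ) (‖c‖ₑ * C) := by
  intro F _ _ _ f
  have : multiplierFun (fun ξ => c * m ξ) f = c • multiplierFun m f := by
    ext x
    simp only [multiplierFun, Pi.smul_apply, Real.fourierInv_eq, mul_smul, ← integral_smul]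
    refine integral_congr_ae (Filter.Eventually.of_forall fun ξ => ?_)
    exact smul_comm _ _ _
  rw [this, eLpNorm_const_smul, mul_assoc]
  gcongr
  exact h F f

/-- The dilates of a Schwartz symbol are uniformly bounded multipliers, being superpositions of
translations with the weight `𝓕 ψ`. -/
theorem LpMultiplierBound.schwartz_dilate {p : ℝ≥0∞} (hp1 : 1 ≤ p) (hp : p ≠ ⊤) (ψ : 𝓢(V, ℂ))
    (c : ℝ) : LpMultiplierBound p (fun ξ => ψ (c • ξ)) (∫⁻ y, ‖𝓕 ψ y‖ₑ) := by
  have hfin : ∫⁻ y, ‖𝓕 ψ y‖ₑ ≠ ⊤ := ((𝓕 ψ).integrable (μ := volume)).2.ne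
  have hc : Function.HasTemperateGrowth fun ξ : V => c • ξ :=
    (c • ContinuousLinearMap.id ℝ V).hasTemperateGrowth
  have hchar (t : ℝ) : ‖((Real.fourierChar t : Circle) : ℂ)‖ₑ = 1 := by
    rw [← ofReal_norm, Circle.norm_coe, ENNReal.ofReal_one]
  refine LpMultiplierBound.superposition (ν := (volume : Measure V)) hp1 hp
    (m := fun y ξ => (Real.fourierChar (inner ℝ y (c • ξ)) : ℂ) * 𝓕 ψ y) ?_
    (ψ.hasTemperateGrowth.comp hc) (K := (∫⁻ y, ‖𝓕 ψ y‖ₑ).toReal) (N := 0) ?_ ?_ ?_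
  · refine Continuous.measurable ?_
    have := (𝓕 ψ).continuous
    unfold Function.uncurry
    fun_prop
  · intro ξ
    have h1 : 𝓕⁻ (𝓕 ψ) (c • ξ) = ψ (c • ξ) := by rw [FourierTransform.fourierInv_fourier_eq]
    rw [SchwartzMap.fourierInv_coe, Real.fourierInv_eq] at h1
    simp only [Circle.smul_def, smul_eq_mul] at h1
    exact h1.symm
  · intro ξ
    simp [hchar, ENNReal.ofReal_toReal hfin]
  · refine Filter.Eventually.of_forall fun y => ?_
    intro F _ _ _ f
    have : multiplierFun (fun ξ => (Real.fourierChar (inner ℝ y (c • ξ)) : ℂ) * 𝓕 ψ y) f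
        = 𝓕 ψ y • fun x => f (x + c • y) := by
      ext x
      have h1 : 𝓕⁻ (𝓕 f) (x + c • y) = f (x + c • y) := by
        rw [FourierTransform.fourierInv_fourier_eq]
      rw [Pi.smul_apply, ← h1, SchwartzMap.fourierInv_coe, multiplierFun, Real.fourierInv_eq,
        Real.fourierInv_eq, ← integral_smul]
      refine integral_congr_ae (Filter.Eventually.of_forall fun ξ => ?_)
      simp only [inner_add_right, AddChar.map_add_eq_mul, Circle.smul_def, Circle.coe_mul,
        inner_smul_right, smul_smul, real_inner_comm y ξ]
      congr 1
      ring
    rw [this, eLpNorm_const_smul,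
      show (fun x => f (x + c • y)) = f ∘ fun x => x + c • y from rfl,
      eLpNorm_comp_measurePreserving f.continuous.aestronglyMeasurable
        (measurePreserving_add_right volume _)]

/-- The symbols `b(ξ) exp (-ρ |ξ|²)`, `ρ > 0`, are `L_p` multipliers of norm `≤ K ρ ^ (-κ)`. -/
def HeatBound (p : ℝ≥0∞) (b : V → ℂ) (κ K : ℝ) : Prop :=
  ∀ ρ : ℝ, 0 < ρ → LpMultiplierBound p
    (fun ξ => b ξ * (Real.exp (-(ρ * ‖ξ‖ ^ 2)) : ℝ)) (ENNReal.ofReal (K * ρ ^ (-κ)))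

theorem exists_heatBound_one {p : ℝ≥0∞} (hp1 : 1 ≤ p) (hp : p ≠ ⊤) :
    ∃ K, 0 ≤ K ∧ HeatBound p (fun _ : V => 1) 0 K := by
  refine ⟨(∫⁻ y, ‖𝓕 (gaussianSchwartz V) y‖ₑ).toReal, ENNReal.toReal_nonneg, fun ρ hρ => ?_⟩
  have hfin := ((𝓕 (gaussianSchwartz V)).integrable (μ := volume)).2.ne
  have := LpMultiplierBound.schwartz_dilate hp1 hp (gaussianSchwartz V) (Real.sqrt ρ)
  simp only [gaussianSchwartz_apply, norm_smul, mul_pow, Real.norm_eq_abs, sq_abs,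
    Real.sq_sqrt hρ.le] at this
  rw [neg_zero, Real.rpow_zero, mul_one, ENNReal.ofReal_toReal hfin]
  simpa using this

/-- The symbol `⟨ξ, v⟩ exp (-ρ |ξ|²)` is `ρ ^ (-1/2)` times a dilate of the Schwartz symbol
`⟨ξ, v⟩ exp (-|ξ|²)`. -/
theorem exists_heatBound_inner {p : ℝ≥0∞} (hp1 : 1 ≤ p) (hp : p ≠ ⊤) (v : V) :
    ∃ K, 0 ≤ K ∧ HeatBound p (fun ξ : V => (inner ℝ ξ v : ℝ)) (1 / 2) K := by
  have hg : Function.HasTemperateGrowth fun ξ : V => ((inner ℝ ξ v : ℝ) : ℂ) := by fun_prop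
  set ψ : 𝓢(V, ℂ) := SchwartzMap.smulLeftCLM ℂ (fun ξ : V => ((inner ℝ ξ v : ℝ) : ℂ))
    (gaussianSchwartz V) with hψ
  refine ⟨(∫⁻ y, ‖𝓕 ψ y‖ₑ).toReal, ENNReal.toReal_nonneg, fun ρ hρ => ?_⟩
  have hfin := ((𝓕 ψ).integrable (μ := volume)).2.ne
  have := (LpMultiplierBound.schwartz_dilate hp1 hp ψ (Real.sqrt ρ)).const_mul
    ((Real.sqrt ρ)⁻¹ : ℝ)
  have hs : 0 < Real.sqrt ρ := Real.sqrt_pos.2 hρ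
  rw [mul_comm, ENNReal.ofReal_mul (by positivity), ENNReal.ofReal_toReal hfin]
  convert this using 1
  · ext ξ
    rw [hψ, SchwartzMap.smulLeftCLM_apply_apply hg, gaussianSchwartz_apply]
    simp only [norm_smul, mul_pow, Real.norm_eq_abs, sq_abs, Real.sq_sqrt hρ.le, smul_eq_mul,
      real_inner_smul_left, ← mul_assoc, ← Complex.ofReal_mul]
    rw [inv_mul_cancel₀ hs.ne', one_mul]
  · congr 1
    rw [← ofReal_norm, Complex.norm_real, Real.norm_of_nonneg (by positivity),
      Real.sqrt_eq_rpow, Real.rpow_neg hρ.le]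

/-- Integrating the heat bound against `ρ ^ (s - 1) exp (-l ρ)`: the Gamma integral turns
Gaussians into powers of `l + |ξ|²`. -/
theorem HeatBound.gamma_integral {p : ℝ≥0∞} (hp1 : 1 ≤ p) (hp : p ≠ ⊤) {b : V → ℂ} {κ K : ℝ}
    (h : HeatBound p b κ K) (hK0 : 0 ≤ K) (hb : b.HasTemperateGrowth) {s l : ℝ} (hs : 0 < s)
    (hl : 0 < l) (hκ : κ < s) :
    LpMultiplierBound p (fun ξ => b ξ * (((l + ‖ξ‖ ^ 2) ^ (-s) : ℝ) : ℂ))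
      (ENNReal.ofReal (K * (Real.Gamma (s - κ) / Real.Gamma s) * l ^ (κ - s))) := by
  have hΓ : 0 < Real.Gamma s := Real.Gamma_pos_of_pos hs
  have hint (r a : ℝ) (hr : 0 < r) (ha : 0 < a) :
      IntegrableOn (fun ρ : ℝ => ρ ^ (a - 1) * Real.exp (-(r * ρ))) (Set.Ioi 0) := by
    have := integrableOn_rpow_mul_exp_neg_mul_rpow (p := 1) (s := a - 1) (b := r) (by linarith)
      one_pos hr
    simpa using this
  have hval (ξ : V) : ∫ ρ in Set.Ioi (0 : ℝ), (Real.Gamma s)⁻¹ *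
      (ρ ^ (s - 1) * Real.exp (-((l + ‖ξ‖ ^ 2) * ρ))) = (l + ‖ξ‖ ^ 2) ^ (-s) := by
    have hpos : 0 < l + ‖ξ‖ ^ 2 := by positivity
    rw [integral_const_mul, Real.integral_rpow_mul_exp_neg_mul_Ioi hs hpos, one_div,
      Real.inv_rpow hpos.le, Real.rpow_neg hpos.le]
    field_simp
  obtain ⟨N, B, hB⟩ := hb.2 0
  simp only [norm_iteratedFDeriv_zero] at hB
  have hsplit (ρ : ℝ) (ξ : V) : Real.exp (-((l + ‖ξ‖ ^ 2) * ρ)) =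
      Real.exp (-(l * ρ)) * Real.exp (-(ρ * ‖ξ‖ ^ 2)) := by
    rw [← Real.exp_add]; congr 1; ring
  have key := LpMultiplierBound.superposition (p := p) hp1 hp
    (ν := (volume : Measure ℝ).restrict (Set.Ioi 0))
    (m := fun ρ ξ => b ξ * (((Real.Gamma s)⁻¹ *
      (ρ ^ (s - 1) * Real.exp (-((l + ‖ξ‖ ^ 2) * ρ))) : ℝ) : ℂ))
    (M := fun ξ => b ξ * (((l + ‖ξ‖ ^ 2) ^ (-s) : ℝ) : ℂ))
    (K := B * l ^ (-s)) (N := N)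
    (C := fun ρ => ENNReal.ofReal ((Real.Gamma s)⁻¹ * K *
      (ρ ^ ((s - κ) - 1) * Real.exp (-(l * ρ))))) ?_
    (hb.mul (hasTemperateGrowth_add_norm_sq_rpow hl _)) ?_ ?_ ?_
  · refine key.mono (le_of_eq ?_)
    rw [← ofReal_integral_eq_lintegral_ofReal ((hint l (s - κ) hl (by linarith)).const_mul _),
      integral_const_mul, Real.integral_rpow_mul_exp_neg_mul_Ioi (by linarith) hl, one_div,
      Real.inv_rpow hl.le, ← Real.rpow_neg hl.le, neg_sub]
    · congr 1
      ring
    · refine (ae_restrict_iff' measurableSet_Ioi).2 (Filter.Eventually.of_forall fun ρ hρ => ?_)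
      have : (0 : ℝ) < ρ := hρ
      positivity
  · have := hb.1.continuous.measurable
    unfold Function.uncurry
    fun_prop
  · intro ξ
    rw [integral_const_mul, integral_complex_ofReal, hval]
  · intro ξ
    have hnn : 0 ≤ᵐ[volume.restrict (Set.Ioi (0 : ℝ))] fun ρ => (Real.Gamma s)⁻¹ *
        (ρ ^ (s - 1) * Real.exp (-((l + ‖ξ‖ ^ 2) * ρ))) := by
      refine (ae_restrict_iff' measurableSet_Ioi).2 (Filter.Eventually.of_forall fun ρ hρ => ?_)
      have : (0 : ℝ) < ρ := hρ
      simp only [Pi.zero_apply]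
      positivity
    have hpos : 0 < l + ‖ξ‖ ^ 2 := by positivity
    calc ∫⁻ ρ in Set.Ioi (0 : ℝ), ‖b ξ * (((Real.Gamma s)⁻¹ *
          (ρ ^ (s - 1) * Real.exp (-((l + ‖ξ‖ ^ 2) * ρ))) : ℝ) : ℂ)‖ₑ
        = ∫⁻ ρ in Set.Ioi (0 : ℝ), ‖b ξ‖ₑ * ENNReal.ofReal ((Real.Gamma s)⁻¹ *
          (ρ ^ (s - 1) * Real.exp (-((l + ‖ξ‖ ^ 2) * ρ)))) := by
          refine lintegral_congr_ae ?_
          filter_upwards [hnn] with ρ hρ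
          rw [enorm_mul, ← ofReal_norm (Complex.ofReal _), Complex.norm_real,
            Real.norm_of_nonneg hρ]
      _ = ‖b ξ‖ₑ * ENNReal.ofReal ((l + ‖ξ‖ ^ 2) ^ (-s)) := by
          rw [lintegral_const_mul' _ _ enorm_ne_top, ← ofReal_integral_eq_lintegral_ofReal
            ((hint _ s hpos hs).const_mul _) hnn, hval]
      _ ≤ _ := by
          rw [← ofReal_norm, ← ENNReal.ofReal_mul (norm_nonneg _)]
          refine ENNReal.ofReal_le_ofReal ?_
          rw [mul_right_comm]
          refine mul_le_mul (hB ξ) ?_ (by positivity) ((norm_nonneg _).trans (hB ξ))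
          exact Real.rpow_le_rpow_of_nonpos hl (by nlinarith [norm_nonneg ξ]) (by linarith)
  · refine (ae_restrict_iff' measurableSet_Ioi).2 (Filter.Eventually.of_forall fun ρ hρ => ?_)
    have hρ0 : (0 : ℝ) < ρ := hρ
    have := (h ρ hρ0).const_mul
      (((Real.Gamma s)⁻¹ * (ρ ^ (s - 1) * Real.exp (-(l * ρ))) : ℝ) : ℂ)
    convert this using 1
    · ext ξ
      rw [hsplit]
      push_cast
      ring
    · rw [← ofReal_norm, Complex.norm_real, Real.norm_of_nonneg (by positivity),
        ← ENNReal.ofReal_mul (by positivity)]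
      congr 1
      rw [show s - κ - 1 = (s - 1) + (-κ) by ring, Real.rpow_add hρ0]
      ring

/-- A factor `(1 + |ξ|²) ^ (-θ)` improves the exponent of a heat bound by any `δ < θ`, as
`(ρ + r) ^ (-(κ + δ)) ≤ ρ ^ (-κ) r ^ (-δ)`. -/
theorem HeatBound.mul_bessel {p : ℝ≥0∞} (hp1 : 1 ≤ p) (hp : p ≠ ⊤) {b : V → ℂ} {κ δ K θ : ℝ}
    (h : HeatBound p b (κ + δ) K) (hK0 : 0 ≤ K) (hb : b.HasTemperateGrowth) (hθ : 0 < θ)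
    (hκ : 0 ≤ κ) (hδ : 0 ≤ δ) (hδθ : δ < θ) :
    HeatBound p (fun ξ => b ξ * (((1 + ‖ξ‖ ^ 2) ^ (-θ) : ℝ) : ℂ)) κ
      (K * (Real.Gamma (θ - δ) / Real.Gamma θ)) := by
  intro ρ hρ
  have h1 : HeatBound p (fun ξ => b ξ * ((Real.exp (-(ρ * ‖ξ‖ ^ 2)) : ℝ) : ℂ)) δ
      (K * ρ ^ (-κ)) := by
    intro r hr
    have h2 := h (ρ + r) (by positivity)
    convert h2.mono (ENNReal.ofReal_le_ofReal (?_ : _ ≤ K * ρ ^ (-κ) * r ^ (-δ))) using 1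
    · ext ξ
      rw [mul_assoc, ← Complex.ofReal_mul, ← Real.exp_add]
      congr 3
      ring
    · rw [neg_add, Real.rpow_add (by positivity), mul_assoc]
      refine mul_le_mul_of_nonneg_left ?_ hK0
      refine mul_le_mul ?_ ?_ (by positivity) (by positivity)
      · exact Real.rpow_le_rpow_of_nonpos hρ (by linarith) (by linarith)
      · exact Real.rpow_le_rpow_of_nonpos hr (by linarith) (by linarith)
  have h3 := h1.gamma_integral hp1 hp (by positivity)
    (hb.mul (hasTemperateGrowth_exp_neg_mul_norm_sq hρ)) hθ one_pos hδθ
  rw [Real.one_rpow, mul_one] at h3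
  convert h3 using 1
  · ext ξ; ring
  · congr 1; ring

end SobolevMultiplier

namespace SobolevMultiplier

open FourierTransform Function LineDeriv

/-! ### Bessel potentials and resolvents on Schwartz functions -/

section

variable {V : Type*} [NormedAddCommGroup V] [InnerProductSpace ℝ V]
  {F : Type*} [NormedAddCommGroup F] [NormedSpace ℂ F]

theorem hasTemperateGrowth_bessel (s : ℝ) :
    Function.HasTemperateGrowth fun ξ : V => (((1 + ‖ξ‖ ^ 2) ^ (s / 2) : ℝ) : ℂ) :=
  hasTemperateGrowth_add_norm_sq_rpow one_pos _

/-- The product of a scalar and a vector-valued Schwartz function. -/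
abbrev smulSchwartz (g : 𝓢(V, ℂ)) (ζ : 𝓢(V, F)) : 𝓢(V, F) :=
  SchwartzMap.pairing (ContinuousLinearMap.lsmul ℂ ℂ) g ζ

theorem smulSchwartz_apply (g : 𝓢(V, ℂ)) (ζ : 𝓢(V, F)) (x : V) :
    smulSchwartz g ζ x = g x • ζ x := by
  simp [smulSchwartz, SchwartzMap.pairing_apply_apply]

theorem lineDeriv_smulSchwartz (v : V) (g : 𝓢(V, ℂ)) (ζ : 𝓢(V, F)) :
    ∂_{v} (smulSchwartz g ζ) = smulSchwartz (∂_{v} g) ζ + smulSchwartz g (∂_{v} ζ) := by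
  ext x
  have h : (smulSchwartz g ζ : V → F) = fun x => g x • ζ x := funext (smulSchwartz_apply g ζ)
  rw [SchwartzMap.lineDerivOp_apply_eq_fderiv, h,
    fderiv_fun_smul g.differentiableAt ζ.differentiableAt]
  simp only [add_apply, smulSchwartz_apply, SchwartzMap.lineDerivOp_apply_eq_fderiv]
  simp [add_comm]

end

variable {V : Type*} [NormedAddCommGroup V] [InnerProductSpace ℝ V] [FiniteDimensional ℝ V]
  [MeasurableSpace V] [BorelSpace V]
  {F : Type*} [NormedAddCommGroup F] [NormedSpace ℂ F]

variable (F) in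
/-- The Bessel potential operator of order `s` on Schwartz functions. -/
def bessel (s : ℝ) : 𝓢(V, F) →L[ℂ] 𝓢(V, F) :=
  SchwartzMap.fourierMultiplierCLM F fun ξ : V => (((1 + ‖ξ‖ ^ 2) ^ (s / 2) : ℝ) : ℂ)

variable (F) in
/-- The resolvent `(t + J²)⁻¹` of the Bessel potential operator `J²` of order two, as an operator
on Schwartz functions. -/
def resolvent (t : ℝ) : 𝓢(V, F) →L[ℂ] 𝓢(V, F) :=
  SchwartzMap.fourierMultiplierCLM F fun ξ : V => (((1 + t + ‖ξ‖ ^ 2) ^ (-1 : ℝ) : ℝ) : ℂ)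

theorem fourierMultiplierCLM_add {m₁ m₂ : V → ℂ} (h₁ : m₁.HasTemperateGrowth)
    (h₂ : m₂.HasTemperateGrowth) (f : 𝓢(V, F)) :
    SchwartzMap.fourierMultiplierCLM F (fun ξ => m₁ ξ + m₂ ξ) f =
      SchwartzMap.fourierMultiplierCLM F m₁ f + SchwartzMap.fourierMultiplierCLM F m₂ f := by
  simp only [SchwartzMap.fourierMultiplierCLM_apply]
  rw [← FourierTransform.fourierInv_add]
  congr 1
  have := SchwartzMap.smulLeftCLM_add (F := F) h₁ h₂
  exact congrArg (fun T : 𝓢(V, F) →L[ℂ] 𝓢(V, F) => T (𝓕 f)) this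

theorem bessel_neg_two_eq_resolvent : bessel F (V := V) (-2) = resolvent F 0 := by
  simp [bessel, resolvent]

variable [CompleteSpace F]

theorem bessel_bessel (s t : ℝ) (f : 𝓢(V, F)) : bessel F s (bessel F t f) = bessel F (s + t) f := by
  rw [bessel, bessel, bessel, SchwartzMap.fourierMultiplierCLM_fourierMultiplierCLM_apply
    (hasTemperateGrowth_bessel s) (hasTemperateGrowth_bessel t)]
  congr 2
  ext ξ
  rw [Pi.mul_apply, ← Complex.ofReal_mul, ← Real.rpow_add (by positivity), add_div]

theorem bessel_zero (f : 𝓢(V, F)) : bessel F 0 f = f := by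
  simp [bessel]

theorem resolvent_bessel_two_add {t : ℝ} (ht : 0 ≤ t) (f : 𝓢(V, F)) :
    resolvent F t (bessel F 2 f + (t : ℂ) • f) = f := by
  have h1 : bessel F 2 f + (t : ℂ) • f = SchwartzMap.fourierMultiplierCLM F
      (fun ξ : V => (((1 + t + ‖ξ‖ ^ 2) ^ (1 : ℝ) : ℝ) : ℂ)) f := by
    have h2 : (t : ℂ) • f = SchwartzMap.fourierMultiplierCLM F (fun _ : V => (t : ℂ)) f := by
      simp
    rw [h2, bessel, ← fourierMultiplierCLM_add (hasTemperateGrowth_bessel 2) (.const _)]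
    congr 2
    ext ξ
    simp only [div_self (two_ne_zero' ℝ), Real.rpow_one]
    push_cast
    ring
  have h3 : (fun ξ : V => (((1 + t + ‖ξ‖ ^ 2) ^ (-1 : ℝ) : ℝ) : ℂ)) *
      (fun ξ : V => (((1 + t + ‖ξ‖ ^ 2) ^ (1 : ℝ) : ℝ) : ℂ)) = fun _ => 1 := by
    ext ξ
    have : 0 < 1 + t + ‖ξ‖ ^ 2 := by positivity
    rw [Pi.mul_apply, ← Complex.ofReal_mul, ← Real.rpow_add this]
    simp
  rw [h1, resolvent, SchwartzMap.fourierMultiplierCLM_fourierMultiplierCLM_apply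
    (hasTemperateGrowth_add_norm_sq_rpow (by positivity) _)
    (hasTemperateGrowth_add_norm_sq_rpow (by positivity) _), h3]
  simp

variable (V) in
/-- The orthonormal basis along which second derivatives are taken. -/
abbrev onb := stdOrthonormalBasis ℝ V

/-- The constant `(2π)⁻²` produced by the normalisation of the Fourier transform. -/
def lapConst : ℂ := ((2 * Real.pi) ^ 2)⁻¹

theorem bessel_two_eq (f : 𝓢(V, F)) :
    bessel F 2 f = f - lapConst • ∑ i, ∂_{onb V i} (∂_{onb V i} f) := by
  have hsq : Function.HasTemperateGrowth fun ξ : V => ((‖ξ‖ ^ 2 : ℝ) : ℂ) := by fun_prop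
  have h1 : bessel F 2 f = f + SchwartzMap.fourierMultiplierCLM F
      (fun ξ : V => ((‖ξ‖ ^ 2 : ℝ) : ℂ)) f := by
    have h2 : f = SchwartzMap.fourierMultiplierCLM F (fun _ : V => (1 : ℂ)) f := by simp
    conv_rhs => enter [1]; rw [h2]
    rw [bessel, ← fourierMultiplierCLM_add (.const _) hsq]
    congr 2
    ext ξ
    simp
  have h3 := SchwartzMap.laplacian_eq_fourierMultiplierCLM f
  rw [SchwartzMap.laplacian_eq_sum (onb V)] at h3
  have h4 : SchwartzMap.fourierMultiplierCLM F (fun ξ : V => ((‖ξ‖ ^ 2 : ℝ) : ℂ)) f =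
      SchwartzMap.fourierMultiplierCLM F (fun ξ : V => ‖ξ‖ ^ 2) f :=
    SchwartzMap.fourierMultiplierCLM_ofReal ℂ (Function.hasTemperateGrowth_norm_sq V) f
  have h5 (r : ℝ) (u : 𝓢(V, F)) : r • u = (r : ℂ) • u := by
    ext x
    simp
  have hpi : ((2 * Real.pi : ℝ) : ℂ) ^ 2 ≠ 0 := by
    exact pow_ne_zero _ (Complex.ofReal_ne_zero.2 (by positivity))
  rw [h1, h4, h3, h5, smul_smul, lapConst, sub_eq_add_neg, ← neg_smul]
  congr 1
  push_cast at hpi ⊢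
  rw [mul_neg, neg_neg, inv_mul_cancel₀ hpi, one_smul]

/-- The product rule for the Bessel potential of order two: the error consists of terms with at most
one derivative on `g`. -/
theorem bessel_two_smulSchwartz (g : 𝓢(V, ℂ)) (ζ : 𝓢(V, F)) :
    bessel F 2 (smulSchwartz g ζ) = smulSchwartz (bessel ℂ 2 g) ζ -
      lapConst • ∑ i, ((2 : ℂ) • smulSchwartz (∂_{onb V i} g) (∂_{onb V i} ζ) +
        smulSchwartz g (∂_{onb V i} (∂_{onb V i} ζ))) := by
  have key : ∑ i, ∂_{onb V i} (∂_{onb V i} (smulSchwartz g ζ)) =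
      smulSchwartz (∑ i, ∂_{onb V i} (∂_{onb V i} g)) ζ +
      ∑ i, ((2 : ℂ) • smulSchwartz (∂_{onb V i} g) (∂_{onb V i} ζ) +
        smulSchwartz g (∂_{onb V i} (∂_{onb V i} ζ))) := by
    have hs : smulSchwartz (∑ i, ∂_{onb V i} (∂_{onb V i} g)) ζ =
        ∑ i, smulSchwartz (∂_{onb V i} (∂_{onb V i} g)) ζ := by
      simp only [smulSchwartz, map_sum, sum_apply]
    rw [hs, ← Finset.sum_add_distrib]
    refine Finset.sum_congr rfl fun i _ => ?_
    simp only [lineDeriv_smulSchwartz, lineDerivOp_add]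
    module
  rw [bessel_two_eq, bessel_two_eq, key]
  simp only [smulSchwartz, map_sub, map_smul, sub_apply, smul_apply]
  module

end SobolevMultiplier

namespace SobolevMultiplier

open FourierTransform Function LineDeriv

variable {V : Type*} [NormedAddCommGroup V] [InnerProductSpace ℝ V] [FiniteDimensional ℝ V]
  [MeasurableSpace V] [BorelSpace V]

/-! ### Norm bounds for the resolvent -/

section norms

variable {F : Type*} [NormedAddCommGroup F] [NormedSpace ℂ F] {p : ℝ≥0∞}

theorem eLpNorm_schwartz_add_le (hp1 : 1 ≤ p) (f g : 𝓢(V, F)) :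
    eLpNorm (f + g : 𝓢(V, F)) p volume ≤ eLpNorm f p volume + eLpNorm g p volume :=
  eLpNorm_add_le f.continuous.aestronglyMeasurable g.continuous.aestronglyMeasurable hp1

theorem eLpNorm_schwartz_sub_le (hp1 : 1 ≤ p) (f g : 𝓢(V, F)) :
    eLpNorm (f - g : 𝓢(V, F)) p volume ≤ eLpNorm f p volume + eLpNorm g p volume :=
  eLpNorm_sub_le f.continuous.aestronglyMeasurable g.continuous.aestronglyMeasurable hp1

theorem eLpNorm_schwartz_smul (c : ℂ) (f : 𝓢(V, F)) :
    eLpNorm (c • f : 𝓢(V, F)) p volume = ‖c‖ₑ * eLpNorm f p volume :=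
  eLpNorm_const_smul c f p volume

theorem eLpNorm_schwartz_sum_le (hp1 : 1 ≤ p) {ι : Type*} (s : Finset ι) (f : ι → 𝓢(V, F)) :
    eLpNorm (∑ i ∈ s, f i : 𝓢(V, F)) p volume ≤ ∑ i ∈ s, eLpNorm (f i) p volume := by
  classical
  induction s using Finset.induction_on with
  | empty =>
    rw [Finset.sum_empty, Finset.sum_empty]
    exact (eLpNorm_zero (ε := F)).le
  | insert a s ha ih =>
    rw [Finset.sum_insert ha, Finset.sum_insert ha]
    exact (eLpNorm_schwartz_add_le hp1 _ _).trans (by gcongr)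

theorem eLpNorm_smulSchwartz_le {g : 𝓢(V, ℂ)} {ζ : 𝓢(V, F)} {B : ℝ} (hB : ∀ x, ‖ζ x‖ ≤ B) :
    eLpNorm (smulSchwartz g ζ) p volume ≤ ENNReal.ofReal B * eLpNorm g p volume := by
  refine eLpNorm_le_mul_eLpNorm_of_ae_le_mul (Filter.Eventually.of_forall fun x => ?_) p
  rw [smulSchwartz_apply, norm_smul, mul_comm]
  gcongr
  exact hB x

end norms

section bounds

variable {p : ℝ≥0∞}

theorem LpMultiplierBound.eLpNorm_le {m : V → ℂ} {C : ℝ≥0∞} (h : LpMultiplierBound p m C)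
    (hm : m.HasTemperateGrowth) {F : Type} [NormedAddCommGroup F] [NormedSpace ℂ F]
    [CompleteSpace F] (f : 𝓢(V, F)) :
    eLpNorm (SchwartzMap.fourierMultiplierCLM F m f) p volume ≤ C * eLpNorm f p volume := by
  rw [← multiplierFun_eq hm]
  exact h F f

theorem lineDeriv_fourierMultiplierCLM {F : Type*} [NormedAddCommGroup F] [NormedSpace ℂ F]
    [CompleteSpace F] (v : V) {m : V → ℂ} (hm : m.HasTemperateGrowth) (f : 𝓢(V, F)) :
    ∂_{v} (SchwartzMap.fourierMultiplierCLM F m f) = (2 * Real.pi * Complex.I) •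
      SchwartzMap.fourierMultiplierCLM F (fun ξ => ((inner ℝ ξ v : ℝ) : ℂ) * m ξ) f := by
  have h : Function.HasTemperateGrowth fun ξ : V => ((inner ℝ ξ v : ℝ) : ℂ) := by fun_prop
  have h1 : Function.HasTemperateGrowth fun ξ : V => inner ℝ ξ v := by fun_prop
  rw [SchwartzMap.lineDeriv_eq_fourierMultiplierCLM,
    ← SchwartzMap.fourierMultiplierCLM_ofReal ℂ h1]
  congr 1
  exact SchwartzMap.fourierMultiplierCLM_fourierMultiplierCLM_apply h hm f

theorem lineDeriv_bessel {F : Type*} [NormedAddCommGroup F] [NormedSpace ℂ F]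
    [CompleteSpace F] (v : V) (s : ℝ) (f : 𝓢(V, F)) :
    ∂_{v} (bessel F s f) = bessel F s (∂_{v} f) := by
  have h : Function.HasTemperateGrowth fun ξ : V => ((inner ℝ ξ v : ℝ) : ℂ) := by fun_prop
  have h1 : Function.HasTemperateGrowth fun ξ : V => inner ℝ ξ v := by fun_prop
  rw [bessel, lineDeriv_fourierMultiplierCLM v (hasTemperateGrowth_bessel s),
    SchwartzMap.lineDeriv_eq_fourierMultiplierCLM,
    ← SchwartzMap.fourierMultiplierCLM_ofReal ℂ h1, map_smul]
  congr 1
  refine Eq.trans ?_ (SchwartzMap.fourierMultiplierCLM_fourierMultiplierCLM_apply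
    (hasTemperateGrowth_bessel s) h f).symm
  congr 2
  ext ξ
  exact mul_comm _ _

variable (V) in
/-- The resolvent is the integral of `exp (-(1 + t) ρ)` times the heat semigroup. -/
theorem exists_resolvent_bound (hp1 : 1 ≤ p) (hp : p ≠ ⊤) :
    ∃ K : ℝ, 0 ≤ K ∧ ∀ t : ℝ, 0 ≤ t → ∀ (F : Type) [NormedAddCommGroup F] [NormedSpace ℂ F]
      [CompleteSpace F] (f : 𝓢(V, F)), eLpNorm (resolvent F t f) p volume ≤
        ENNReal.ofReal (K * (1 + t) ^ (-1 : ℝ)) * eLpNorm f p volume := by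
  obtain ⟨K, hK0, hK⟩ := exists_heatBound_one (V := V) hp1 hp
  refine ⟨K * (Real.Gamma (1 - 0) / Real.Gamma 1), by simp [hK0], fun t ht F _ _ _ f => ?_⟩
  have h := hK.gamma_integral hp1 hp hK0 (.const _) one_pos (l := 1 + t) (by positivity) one_pos
  simp only [one_mul, zero_sub] at h
  exact h.eLpNorm_le (hasTemperateGrowth_add_norm_sq_rpow (by positivity) _) f

variable (V) in
theorem exists_bessel_neg_two_bound (hp1 : 1 ≤ p) (hp : p ≠ ⊤) :
    ∃ K : ℝ≥0, ∀ (F : Type) [NormedAddCommGroup F] [NormedSpace ℂ F] [CompleteSpace F]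
      (f : 𝓢(V, F)), eLpNorm (bessel F (-2) f) p volume ≤ K * eLpNorm f p volume := by
  obtain ⟨K, -, hK⟩ := exists_resolvent_bound V hp1 hp
  refine ⟨K.toNNReal, fun F _ _ _ f => ?_⟩
  rw [bessel_neg_two_eq_resolvent]
  have h := hK 0 le_rfl F f
  rw [add_zero, Real.one_rpow, mul_one] at h
  exact h

theorem exists_lineDeriv_bessel_neg_two_bound (hp1 : 1 ≤ p) (hp : p ≠ ⊤) (v : V) :
    ∃ K : ℝ≥0, ∀ (F : Type) [NormedAddCommGroup F] [NormedSpace ℂ F] [CompleteSpace F]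
      (f : 𝓢(V, F)), eLpNorm (∂_{v} (bessel F (-2) f) : 𝓢(V, F)) p volume ≤
        K * eLpNorm f p volume := by
  obtain ⟨K, hK0, hK⟩ := exists_heatBound_inner (V := V) hp1 hp v
  have hv : Function.HasTemperateGrowth fun ξ : V => ((inner ℝ ξ v : ℝ) : ℂ) := by fun_prop
  have h := hK.gamma_integral hp1 hp hK0 hv (s := 1) one_pos one_pos (by norm_num)
  rw [Real.one_rpow, mul_one] at h
  set D := K * (Real.Gamma (1 - 1 / 2) / Real.Gamma 1)
  refine ⟨‖(2 * Real.pi * Complex.I : ℂ)‖₊ * D.toNNReal, fun F _ _ _ f => ?_⟩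
  rw [bessel, lineDeriv_fourierMultiplierCLM v (hasTemperateGrowth_bessel _),
    eLpNorm_schwartz_smul, ENNReal.coe_mul, mul_assoc (_ : ℝ≥0∞)]
  simp only [neg_div, div_self (two_ne_zero' ℝ)]
  refine mul_le_mul_right (α := ℝ≥0∞) ?_ _
  exact h.eLpNorm_le (hv.mul (hasTemperateGrowth_add_norm_sq_rpow one_pos _)) f

variable (V) in
/-- The decay rate is that of `exists_lineDeriv_resolvent_bessel_bound`, which is the slower one. -/
theorem exists_resolvent_bessel_bound (hp1 : 1 ≤ p) (hp : p ≠ ⊤) {θ : ℝ} (hθ0 : 0 < θ)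
    (hθ1 : θ < 1) :
    ∃ K : ℝ, 0 ≤ K ∧ ∀ t : ℝ, 0 ≤ t → ∀ (F : Type) [NormedAddCommGroup F] [NormedSpace ℂ F]
      [CompleteSpace F] (f : 𝓢(V, F)), eLpNorm (resolvent F t (bessel F (-(2 * θ)) f)) p volume ≤
        ENNReal.ofReal (K * (1 + t) ^ (-((1 + θ) / 2))) * eLpNorm f p volume := by
  obtain ⟨K, hK0, hK⟩ := exists_heatBound_one (V := V) hp1 hp
  have h1 := HeatBound.mul_bessel (κ := 0) (δ := 0) hp1 hp (by simpa using hK) hK0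
    (.const _) hθ0 le_rfl le_rfl hθ0
  set D := K * (Real.Gamma (θ - 0) / Real.Gamma θ) with hD
  have hD0 : 0 ≤ D := by
    rw [hD, sub_zero, div_self (Real.Gamma_pos_of_pos hθ0).ne', mul_one]; exact hK0
  refine ⟨D * (Real.Gamma (1 - 0) / Real.Gamma 1), by simp [hD0], fun t ht F _ _ _ f => ?_⟩
  have htemp := hasTemperateGrowth_add_norm_sq_rpow (V := V) one_pos (-θ)
  have h2 := h1.gamma_integral hp1 hp hD0 (by simpa using htemp) one_pos (l := 1 + t)
    (by positivity) one_pos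
  have h3 := h2.mono (ENNReal.ofReal_le_ofReal (?_ : _ ≤
    D * (Real.Gamma (1 - 0) / Real.Gamma 1) * (1 + t) ^ (-((1 + θ) / 2))))
  · simp only [one_mul] at h3
    rw [resolvent, bessel, SchwartzMap.fourierMultiplierCLM_fourierMultiplierCLM_apply
      (hasTemperateGrowth_add_norm_sq_rpow (by positivity) _) (hasTemperateGrowth_bessel _)]
    have hsym : (fun ξ : V => (((1 + t + ‖ξ‖ ^ 2) ^ (-1 : ℝ) : ℝ) : ℂ)) *
        (fun ξ : V => (((1 + ‖ξ‖ ^ 2) ^ (-(2 * θ) / 2) : ℝ) : ℂ)) = fun ξ =>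
        (((1 + ‖ξ‖ ^ 2) ^ (-θ) : ℝ) : ℂ) * (((1 + t + ‖ξ‖ ^ 2) ^ (-1 : ℝ) : ℝ) : ℂ) := by
      ext ξ
      rw [Pi.mul_apply, mul_comm, show -(2 * θ) / 2 = -θ by ring]
    rw [hsym]
    exact h3.eLpNorm_le (htemp.mul (hasTemperateGrowth_add_norm_sq_rpow (by positivity) _)) f
  · refine mul_le_mul_of_nonneg_left ?_ (by simp [hD0])
    exact Real.rpow_le_rpow_of_exponent_le (by linarith) (by linarith)

/-- A derivative costs a factor `ρ ^ (-1/2)` in the heat bound; `J ^ (-2 θ)` recovers `ρ ^ (θ/2)` of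
it, and the Gamma integral for the resolvent turns `ρ ^ (-(1 - θ)/2)` into the rate in `t`. -/
theorem exists_lineDeriv_resolvent_bessel_bound (hp1 : 1 ≤ p) (hp : p ≠ ⊤) (v : V) {θ : ℝ}
    (hθ0 : 0 < θ) (hθ1 : θ < 1) :
    ∃ K : ℝ, 0 ≤ K ∧ ∀ t : ℝ, 0 ≤ t → ∀ (F : Type) [NormedAddCommGroup F] [NormedSpace ℂ F]
      [CompleteSpace F] (f : 𝓢(V, F)),
      eLpNorm (∂_{v} (resolvent F t (bessel F (-(2 * θ)) f)) : 𝓢(V, F)) p volume ≤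
        ENNReal.ofReal (K * (1 + t) ^ (-((1 + θ) / 2))) * eLpNorm f p volume := by
  obtain ⟨K, hK0, hK⟩ := exists_heatBound_inner (V := V) hp1 hp v
  have hv : Function.HasTemperateGrowth fun ξ : V => ((inner ℝ ξ v : ℝ) : ℂ) := by fun_prop
  have h1 := HeatBound.mul_bessel (κ := (1 - θ) / 2) (δ := θ / 2) hp1 hp
    (by convert hK using 1; ring) hK0 hv hθ0 (by linarith) (by linarith) (by linarith)
  set D := K * (Real.Gamma (θ - θ / 2) / Real.Gamma θ) with hD
  have hΓ1 := Real.Gamma_pos_of_pos hθ0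
  have hΓ2 := Real.Gamma_pos_of_pos (show 0 < θ - θ / 2 by linarith)
  have hΓ3 := Real.Gamma_pos_of_pos (show 0 < 1 - (1 - θ) / 2 by linarith)
  have hD0 : 0 ≤ D := by positivity
  set D' := D * (Real.Gamma (1 - (1 - θ) / 2) / Real.Gamma 1) with hD'
  have hD'0 : 0 ≤ D' := by rw [hD', Real.Gamma_one]; positivity
  refine ⟨‖(2 * Real.pi * Complex.I : ℂ)‖ * D', by positivity, fun t ht F _ _ _ f => ?_⟩
  have htemp := hasTemperateGrowth_add_norm_sq_rpow (V := V) one_pos (-θ)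
  have hres := hasTemperateGrowth_add_norm_sq_rpow (V := V) (show 0 < 1 + t by positivity) (-1)
  have h2 := h1.gamma_integral hp1 hp hD0 (hv.mul htemp) one_pos (l := 1 + t)
    (by positivity) (by linarith)
  have hsym : (fun ξ : V => ((inner ℝ ξ v : ℝ) : ℂ) *
      ((fun ξ : V => (((1 + t + ‖ξ‖ ^ 2) ^ (-1 : ℝ) : ℝ) : ℂ)) *
        (fun ξ : V => (((1 + ‖ξ‖ ^ 2) ^ (-(2 * θ) / 2) : ℝ) : ℂ))) ξ) = fun ξ =>
      ((inner ℝ ξ v : ℝ) : ℂ) * (((1 + ‖ξ‖ ^ 2) ^ (-θ) : ℝ) : ℂ) *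
        (((1 + t + ‖ξ‖ ^ 2) ^ (-1 : ℝ) : ℝ) : ℂ) := by
    ext ξ
    rw [Pi.mul_apply, mul_assoc, mul_comm (((1 + t + ‖ξ‖ ^ 2) ^ (-1 : ℝ) : ℝ) : ℂ),
      show -(2 * θ) / 2 = -θ by ring]
  have h3 := h2.eLpNorm_le ((hv.mul htemp).mul hres) f
  rw [show (1 - θ) / 2 - 1 = -((1 + θ) / 2) by ring] at h3
  rw [resolvent, bessel, SchwartzMap.fourierMultiplierCLM_fourierMultiplierCLM_apply
      hres (hasTemperateGrowth_bessel _),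
      lineDeriv_fourierMultiplierCLM v (hres.mul (hasTemperateGrowth_bessel _)), hsym,
      eLpNorm_schwartz_smul, mul_assoc ‖_‖, ENNReal.ofReal_mul (norm_nonneg _), ofReal_norm,
      mul_assoc ‖_‖ₑ]
  exact mul_le_mul_right (α := ℝ≥0∞) h3 _

end bounds

end SobolevMultiplier

namespace SobolevMultiplier

open FourierTransform Function LineDeriv

/-! ### Multiplication by uniformly smooth families -/

section uniformlySmooth

variable {V : Type*} [NormedAddCommGroup V] [InnerProductSpace ℝ V]
  {I : Type*} {F : I → Type} [∀ i, NormedAddCommGroup (F i)] [∀ i, NormedSpace ℂ (F i)]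

/-- A family of Schwartz functions, with values in possibly different spaces, whose derivatives of
each order are bounded uniformly over the family. -/
def UniformlySmooth (ζ : ∀ i, 𝓢(V, F i)) : Prop :=
  ∀ k : ℕ, ∃ C : ℝ, ∀ i x, ‖iteratedFDeriv ℝ k (ζ i) x‖ ≤ C

theorem UniformlySmooth.lineDeriv {ζ : ∀ i, 𝓢(V, F i)} (h : UniformlySmooth ζ) (v : V) :
    UniformlySmooth fun i => (∂_{v} (ζ i) : 𝓢(V, F i)) := by
  intro k
  obtain ⟨C, hC⟩ := h (k + 1)
  refine ⟨‖v‖ * C, fun i x => ?_⟩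
  have h1 : ((∂_{v} (ζ i) : 𝓢(V, F i)) : V → F i) =
      ContinuousLinearMap.apply ℝ (F i) v ∘ fderiv ℝ (ζ i) := by
    ext y
    rw [SchwartzMap.lineDerivOp_apply_eq_fderiv]
    rfl
  have hd : ContDiffAt ℝ k (fderiv ℝ (ζ i)) x :=
    (((ζ i).smooth (⊤ : ℕ∞)).fderiv_right (m := k) (by norm_cast; exact le_top)).contDiffAt
  rw [h1]
  refine ((ContinuousLinearMap.apply ℝ (F i) v).norm_iteratedFDeriv_comp_left hd le_rfl).trans ?_
  rw [norm_iteratedFDeriv_fderiv]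
  refine mul_le_mul ?_ (hC i x) (norm_nonneg _) (norm_nonneg _)
  refine ContinuousLinearMap.opNorm_le_bound _ (norm_nonneg _) fun T => ?_
  rw [mul_comm]
  exact T.le_opNorm v

theorem UniformlySmooth.exists_norm_le {ζ : ∀ i, 𝓢(V, F i)} (h : UniformlySmooth ζ) :
    ∃ B : ℝ≥0, ∀ i x, ‖ζ i x‖ ≤ B := by
  obtain ⟨C, hC⟩ := h 0
  simp only [norm_iteratedFDeriv_zero] at hC
  exact ⟨C.toNNReal, fun i x => (hC i x).trans (Real.le_coe_toNNReal C)⟩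

end uniformlySmooth

/-! ### The Bessel potential as an integral of resolvents -/

/-- The symbol `c t ^ θ (t⁻¹ - (t + 1 + |ξ|²)⁻¹)`, whose integral over `t > 0` is
`(1 + |ξ|²) ^ θ`. -/
def powerSymbol (V : Type*) [NormedAddCommGroup V] (θ t : ℝ) (ξ : V) : ℂ :=
  (((∫ t in Set.Ioi 0, Real.rpowIntegrand₀₁ θ t 1)⁻¹ *
    Real.rpowIntegrand₀₁ θ t (1 + ‖ξ‖ ^ 2) : ℝ) : ℂ)

section powerSymbol

variable {V : Type*} [NormedAddCommGroup V]

theorem measurable_powerSymbol [MeasurableSpace V] [OpensMeasurableSpace V] (θ : ℝ) :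
    Measurable (uncurry (powerSymbol V θ)) := by
  unfold powerSymbol Real.rpowIntegrand₀₁ uncurry
  fun_prop

theorem integral_powerSymbol {θ : ℝ} (hθ : θ ∈ Set.Ioo (0 : ℝ) 1) (ξ : V) :
    ∫ t in Set.Ioi 0, powerSymbol V θ t ξ = (((1 + ‖ξ‖ ^ 2) ^ (2 * θ / 2) : ℝ) : ℂ) := by
  unfold powerSymbol
  rw [integral_complex_ofReal, integral_const_mul,
    ← Real.rpow_eq_const_mul_integral hθ (by positivity)]
  congr 2
  ring

theorem lintegral_powerSymbol_le {θ : ℝ} (hθ : θ ∈ Set.Ioo (0 : ℝ) 1) (ξ : V) :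
    ∫⁻ t in Set.Ioi 0, ‖powerSymbol V θ t ξ‖ₑ ≤ ENNReal.ofReal (1 * (1 + ‖ξ‖) ^ 2) := by
  have hnn (x : ℝ) (hx : 0 ≤ x) : 0 ≤ᵐ[volume.restrict (Set.Ioi 0)]
      fun t => Real.rpowIntegrand₀₁ θ t x :=
    (ae_restrict_iff' measurableSet_Ioi).2 (Filter.Eventually.of_forall fun t ht =>
      Real.rpowIntegrand₀₁_nonneg hθ.1 (le_of_lt ht) hx)
  have hc : 0 ≤ (∫ t in Set.Ioi 0, Real.rpowIntegrand₀₁ θ t 1)⁻¹ :=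
    inv_nonneg.2 (integral_nonneg_of_ae (hnn 1 zero_le_one))
  have hx : 0 ≤ 1 + ‖ξ‖ ^ 2 := by positivity
  have h1 : ∫⁻ t in Set.Ioi 0, ‖powerSymbol V θ t ξ‖ₑ = ∫⁻ t in Set.Ioi 0,
      ENNReal.ofReal ((∫ t in Set.Ioi 0, Real.rpowIntegrand₀₁ θ t 1)⁻¹ *
        Real.rpowIntegrand₀₁ θ t (1 + ‖ξ‖ ^ 2)) := by
    refine lintegral_congr_ae ?_
    filter_upwards [hnn _ hx] with t ht
    rw [powerSymbol, ← ofReal_norm, Complex.norm_real, Real.norm_of_nonneg (mul_nonneg hc ht)]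
  rw [h1, ← ofReal_integral_eq_lintegral_ofReal
    ((Real.integrableOn_rpowIntegrand₀₁_Ioi hθ hx).const_mul _), integral_const_mul,
    ← Real.rpow_eq_const_mul_integral hθ hx]
  · refine ENNReal.ofReal_le_ofReal ?_
    calc (1 + ‖ξ‖ ^ 2) ^ θ ≤ (1 + ‖ξ‖ ^ 2) ^ (1 : ℝ) :=
          Real.rpow_le_rpow_of_exponent_le (by nlinarith [norm_nonneg ξ]) hθ.2.le
      _ ≤ _ := by
          rw [Real.rpow_one]
          nlinarith [norm_nonneg ξ]
  · filter_upwards [hnn _ hx] with t ht using mul_nonneg hc ht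

end powerSymbol

variable {V : Type*} [NormedAddCommGroup V] [InnerProductSpace ℝ V] [FiniteDimensional ℝ V]
  [MeasurableSpace V] [BorelSpace V]

theorem bessel_two_resolvent_add {F : Type*} [NormedAddCommGroup F] [NormedSpace ℂ F]
    [CompleteSpace F] {t : ℝ} (ht : 0 ≤ t) (f : 𝓢(V, F)) :
    bessel F 2 (resolvent F t f) + (t : ℂ) • resolvent F t f = f := by
  have hres := hasTemperateGrowth_add_norm_sq_rpow (V := V) (show 0 < 1 + t by positivity) (-1)
  have h : bessel F 2 (resolvent F t f) = resolvent F t (bessel F 2 f) := by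
    rw [bessel, resolvent, SchwartzMap.fourierMultiplierCLM_fourierMultiplierCLM_apply
      (hasTemperateGrowth_bessel _) hres,
      SchwartzMap.fourierMultiplierCLM_fourierMultiplierCLM_apply hres
      (hasTemperateGrowth_bessel _), mul_comm]
  rw [h, ← map_smul, ← map_add, resolvent_bessel_two_add ht]

/-- The commutator of the resolvent with a multiplication is the resolvent applied to a
differential expression of order one in the resolvent. -/
theorem resolvent_commutator {F : Type*} [NormedAddCommGroup F] [NormedSpace ℂ F]
    [CompleteSpace F] {t : ℝ} (ht : 0 ≤ t) (v : 𝓢(V, ℂ)) (ζ : 𝓢(V, F)) :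
    smulSchwartz (resolvent ℂ t v) ζ - resolvent F t (smulSchwartz v ζ) =
      resolvent F t ((-lapConst) • ∑ i,
        ((2 : ℂ) • smulSchwartz (∂_{onb V i} (resolvent ℂ t v)) (∂_{onb V i} ζ) +
        smulSchwartz (resolvent ℂ t v) (∂_{onb V i} (∂_{onb V i} ζ)))) := by
  set w := resolvent ℂ t v with hw
  have hv : v = bessel ℂ 2 w + (t : ℂ) • w := (bessel_two_resolvent_add ht v).symm
  have h1 : smulSchwartz v ζ = smulSchwartz (bessel ℂ 2 w) ζ + (t : ℂ) • smulSchwartz w ζ := by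
    rw [hv]
    simp only [smulSchwartz, map_add, map_smul, add_apply, smul_apply]
  have h2 := resolvent_bessel_two_add ht (smulSchwartz w ζ)
  rw [bessel_two_smulSchwartz] at h2
  rw [h1]
  nth_rewrite 1 [← h2]
  rw [← map_sub]
  congr 1
  module

/-- The commutator of the resolvent with a multiplication, composed with `J ^ (-2 θ)`, decays in `t`
faster than `t ^ (-1 - θ)`: the outer resolvent contributes `(1 + t)⁻¹`, and the inner one, with at
most one derivative, contributes `(1 + t) ^ (-(1 + θ) / 2)`. -/
theorem exists_commutator_bound {p : ℝ≥0∞} (hp1 : 1 ≤ p) (hp : p ≠ ⊤) {θ : ℝ} (hθ0 : 0 < θ)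
    (hθ1 : θ < 1) {I : Type*} {F : I → Type} [∀ i, NormedAddCommGroup (F i)]
    [∀ i, NormedSpace ℂ (F i)] [∀ i, CompleteSpace (F i)] {ζ : ∀ i, 𝓢(V, F i)}
    (hζ : UniformlySmooth ζ) :
    ∃ D : ℝ≥0, ∀ t : ℝ, 0 ≤ t → ∀ i (g : 𝓢(V, ℂ)),
      eLpNorm (smulSchwartz (resolvent ℂ t (bessel ℂ (-(2 * θ)) g)) (ζ i) -
          resolvent (F i) t (smulSchwartz (bessel ℂ (-(2 * θ)) g) (ζ i)) : 𝓢(V, F i)) p volume ≤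
        D * ENNReal.ofReal ((1 + t) ^ (-1 - (1 + θ) / 2)) * eLpNorm g p volume := by
  obtain ⟨K, hK0, hK⟩ := exists_resolvent_bound V hp1 hp
  obtain ⟨K2, hK20, hK2⟩ := exists_resolvent_bessel_bound V hp1 hp hθ0 hθ1
  choose K1 hK10 hK1 using fun j => exists_lineDeriv_resolvent_bessel_bound hp1 hp (onb V j) hθ0 hθ1
  choose B1 hB1 using fun j => (hζ.lineDeriv (onb V j)).exists_norm_le
  choose B2 hB2 using fun j => ((hζ.lineDeriv (onb V j)).lineDeriv (onb V j)).exists_norm_le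
  refine ⟨K.toNNReal * ‖-lapConst‖₊ * ∑ j, (2 * (B1 j * (K1 j).toNNReal) + B2 j * K2.toNNReal),
    fun t ht i g => ?_⟩
  set w := resolvent ℂ t (bessel ℂ (-(2 * θ)) g) with hw
  have e (A : ℝ) (hA : 0 ≤ A) (r : ℝ) : ENNReal.ofReal (A * (1 + t) ^ r) =
      (A.toNNReal : ℝ≥0∞) * ENNReal.ofReal ((1 + t) ^ r) := by
    rw [ENNReal.ofReal_mul hA]; rfl
  have hsplit : ENNReal.ofReal ((1 + t) ^ (-1 - (1 + θ) / 2)) =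
      ENNReal.ofReal ((1 + t) ^ (-1 : ℝ)) * ENNReal.ofReal ((1 + t) ^ (-((1 + θ) / 2))) := by
    rw [← ENNReal.ofReal_mul (by positivity), ← Real.rpow_add (by positivity)]
    rfl
  rw [resolvent_commutator ht]
  refine (hK t ht (F i) _).trans ?_
  rw [e K hK0, eLpNorm_schwartz_smul, hsplit]
  have hterm (j) : eLpNorm ((2 : ℂ) • smulSchwartz (∂_{onb V j} w) (∂_{onb V j} (ζ i)) +
      smulSchwartz w (∂_{onb V j} (∂_{onb V j} (ζ i))) : 𝓢(V, F i)) p volume ≤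
      ((2 * (B1 j * (K1 j).toNNReal) + B2 j * K2.toNNReal : ℝ≥0) : ℝ≥0∞) *
        (ENNReal.ofReal ((1 + t) ^ (-((1 + θ) / 2))) * eLpNorm g p volume) := by
    have h1 := eLpNorm_smulSchwartz_le (p := p) (g := ∂_{onb V j} w) (hB1 j i)
    have h2 := eLpNorm_smulSchwartz_le (p := p) (g := w) (hB2 j i)
    have h3 := hK1 j t ht ℂ g
    have h4 := hK2 t ht ℂ g
    rw [e _ (hK10 j)] at h3
    rw [e _ hK20] at h4
    rw [ENNReal.ofReal_coe_nnreal] at h1 h2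
    refine (eLpNorm_schwartz_add_le hp1 _ _).trans ?_
    rw [eLpNorm_schwartz_smul]
    have h5 : ‖(2 : ℂ)‖ₑ = 2 := by simp [← ofReal_norm]
    rw [h5]
    calc _ ≤ 2 * ((B1 j : ℝ≥0∞) * (((K1 j).toNNReal : ℝ≥0∞) *
          ENNReal.ofReal ((1 + t) ^ (-((1 + θ) / 2))) * eLpNorm g p volume)) +
          (B2 j : ℝ≥0∞) * ((K2.toNNReal : ℝ≥0∞) *
          ENNReal.ofReal ((1 + t) ^ (-((1 + θ) / 2))) * eLpNorm g p volume) := by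
          gcongr
          · exact h1.trans (by gcongr)
          · exact h2.trans (by gcongr)
      _ = _ := by push_cast; ring
  calc _ ≤ (K.toNNReal : ℝ≥0∞) * ENNReal.ofReal ((1 + t) ^ (-1 : ℝ)) * (‖-lapConst‖ₑ *
        ∑ j, ((2 * (B1 j * (K1 j).toNNReal) + B2 j * K2.toNNReal : ℝ≥0) : ℝ≥0∞) *
        (ENNReal.ofReal ((1 + t) ^ (-((1 + θ) / 2))) * eLpNorm g p volume)) := by
        gcongr
        exact (eLpNorm_schwartz_sum_le hp1 _ _).trans (Finset.sum_le_sum fun j _ => hterm j)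
    _ = _ := by
        rw [← Finset.sum_mul, ENNReal.coe_mul, ENNReal.coe_mul, ENNReal.ofNNReal_finsetSum]
        simp only [enorm_eq_nnnorm]
        ring

/-- The operator with symbol `powerSymbol V θ t` is a multiple of `t⁻¹ - R_t`. -/
theorem multiplierFun_powerSymbol {F : Type*} [NormedAddCommGroup F] [NormedSpace ℂ F]
    [CompleteSpace F] (θ : ℝ) {t : ℝ} (ht : 0 < t) (f : 𝓢(V, F)) :
    multiplierFun (powerSymbol V θ t) f =
      (((((∫ t in Set.Ioi 0, Real.rpowIntegrand₀₁ θ t 1)⁻¹ * t ^ θ : ℝ) : ℂ)) •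
        (((t⁻¹ : ℝ) : ℂ) • f - resolvent F t f) : 𝓢(V, F)) := by
  set A : ℂ := (((∫ t in Set.Ioi 0, Real.rpowIntegrand₀₁ θ t 1)⁻¹ * t ^ θ : ℝ) : ℂ) with hA
  have hres := hasTemperateGrowth_add_norm_sq_rpow (V := V) (show 0 < 1 + t by positivity) (-1)
  have hs : powerSymbol V θ t = fun ξ => (A * ((t⁻¹ : ℝ) : ℂ)) +
      ((-A) • fun ξ : V => (((1 + t + ‖ξ‖ ^ 2) ^ (-1 : ℝ) : ℝ) : ℂ)) ξ := by
    ext ξ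
    rw [powerSymbol, Real.rpowIntegrand₀₁, Pi.smul_apply, smul_eq_mul, Real.rpow_neg_one, hA,
      show t + (1 + ‖ξ‖ ^ 2) = 1 + t + ‖ξ‖ ^ 2 by ring]
    push_cast
    ring
  have hres' : Function.HasTemperateGrowth
      ((-A) • fun ξ : V => (((1 + t + ‖ξ‖ ^ 2) ^ (-1 : ℝ) : ℝ) : ℂ)) :=
    (HasTemperateGrowth.const (-A)).mul hres
  have htot : Function.HasTemperateGrowth fun ξ : V => (A * ((t⁻¹ : ℝ) : ℂ)) +
      ((-A) • fun ξ : V => (((1 + t + ‖ξ‖ ^ 2) ^ (-1 : ℝ) : ℝ) : ℂ)) ξ :=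
    (HasTemperateGrowth.const _).add hres'
  rw [hs, multiplierFun_eq htot,
    fourierMultiplierCLM_add (.const _) hres', SchwartzMap.fourierMultiplierCLM_smul hres,
    SchwartzMap.fourierMultiplierCLM_const, resolvent]
  congr 1
  simp only [smul_apply, ContinuousLinearMap.id_apply]
  module

end SobolevMultiplier

namespace SobolevMultiplier

open FourierTransform Function LineDeriv

/-! ### Stability of the Bessel potential norms under uniformly smooth multiplications -/

/-- Multiplication by the members of a uniformly smooth family is bounded, uniformly over the
family, in the norm `‖J ^ a f‖_{L_p}` on Schwartz functions, `J ^ a` being the Bessel potential. -/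
def BesselStable (V : Type*) [NormedAddCommGroup V] [InnerProductSpace ℝ V]
    [FiniteDimensional ℝ V] [MeasurableSpace V] [BorelSpace V] (p : ℝ≥0∞) (a : ℝ) : Prop :=
  ∀ (I : Type) (F : I → Type) [∀ i, NormedAddCommGroup (F i)] [∀ i, NormedSpace ℂ (F i)]
    [∀ i, CompleteSpace (F i)] (ζ : ∀ i, 𝓢(V, F i)), UniformlySmooth ζ →
    ∃ C : ℝ≥0, ∀ i (g : 𝓢(V, ℂ)),
      eLpNorm (bessel (F i) a (smulSchwartz (bessel ℂ (-a) g) (ζ i))) p volume ≤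
        C * eLpNorm g p volume

variable {V : Type*} [NormedAddCommGroup V] [InnerProductSpace ℝ V] [FiniteDimensional ℝ V]
  [MeasurableSpace V] [BorelSpace V] {p : ℝ≥0∞}

theorem besselStable_zero : BesselStable V p 0 := by
  intro I F _ _ _ ζ hζ
  obtain ⟨B, hB⟩ := hζ.exists_norm_le
  refine ⟨B, fun i g => ?_⟩
  rw [neg_zero, bessel_zero, bessel_zero]
  refine (eLpNorm_smulSchwartz_le (hB i)).trans ?_
  rw [ENNReal.ofReal_coe_nnreal]

theorem lintegral_rpow_mul_rpow_ne_top {θ : ℝ} (hθ0 : 0 < θ) (hθ1 : θ < 1) :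
    ∫⁻ t in Set.Ioi (0 : ℝ), ENNReal.ofReal (t ^ θ * (1 + t) ^ (-1 - (1 + θ) / 2)) ≠ ⊤ := by
  have h := integrableOn_add_rpow_Ioi_of_lt (a := -1 + θ - (1 + θ) / 2) (c := 0) (m := 1)
    (by linarith) (by norm_num)
  refine ne_top_of_le_ne_top h.lintegral_lt_top.ne ?_
  refine setLIntegral_mono' measurableSet_Ioi fun t ht => ENNReal.ofReal_le_ofReal ?_
  have ht0 : (0 : ℝ) < t := ht
  calc t ^ θ * (1 + t) ^ (-1 - (1 + θ) / 2)
      ≤ (1 + t) ^ θ * (1 + t) ^ (-1 - (1 + θ) / 2) := by gcongr; linarith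
    _ = (t + 1) ^ (-1 + θ - (1 + θ) / 2) := by
        rw [← Real.rpow_add (by positivity), add_comm 1 t]; ring_nf

/-- For orders strictly between `0` and `2` the commutator of the Bessel potential with a
multiplication is a superposition of commutators of resolvents. -/
theorem besselStable_of_pos_of_lt_two (hp1 : 1 ≤ p) (hp : p ≠ ⊤) {θ : ℝ} (hθ0 : 0 < θ)
    (hθ1 : θ < 1) : BesselStable V p (2 * θ) := by
  intro I F _ _ _ ζ hζ
  have hθ : θ ∈ Set.Ioo (0 : ℝ) 1 := ⟨hθ0, hθ1⟩
  obtain ⟨B, hB⟩ := hζ.exists_norm_le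
  obtain ⟨D, hD⟩ := exists_commutator_bound hp1 hp hθ0 hθ1 hζ
  set c : ℝ := (∫ t in Set.Ioi 0, Real.rpowIntegrand₀₁ θ t 1)⁻¹ with hc
  set L := ∫⁻ t in Set.Ioi (0 : ℝ), ENNReal.ofReal (t ^ θ * (1 + t) ^ (-1 - (1 + θ) / 2)) with hL
  have hLtop : L ≠ ⊤ := lintegral_rpow_mul_rpow_ne_top hθ0 hθ1
  refine ⟨B + ‖c‖₊ * D * L.toNNReal, fun i g => ?_⟩
  set v := bessel ℂ (-(2 * θ)) g with hv
  set w := smulSchwartz v (ζ i) with hw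
  have hgv : g = bessel ℂ (2 * θ) v := by
    rw [hv, bessel_bessel, add_neg_cancel, bessel_zero]
  have hm := measurable_powerSymbol (V := V) θ
  have hrep {E : Type} [NormedAddCommGroup E] [NormedSpace ℂ E] [CompleteSpace E]
      (f : 𝓢(V, E)) (x : V) :
      bessel E (2 * θ) f x = ∫ t in Set.Ioi 0, multiplierFun (powerSymbol V θ t) f x := by
    rw [← multiplierFun_integral hm f (lintegral_powerSymbol_le hθ) x]
    simp only [integral_powerSymbol hθ]
    rw [multiplierFun_eq (hasTemperateGrowth_bessel _)]
    rfl
  -- the terms with `t⁻¹` cancel in the commutator, which leaves those with `R_t`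
  set u : 𝓢(V, F i) := bessel (F i) (2 * θ) w - smulSchwartz g (ζ i) with hu
  have hmain : eLpNorm u p volume ≤ ‖c‖ₑ * D * L * eLpNorm g p volume := by
    have hmeas : StronglyMeasurable (uncurry fun (t : ℝ) (x : V) =>
        multiplierFun (powerSymbol V θ t) w x - multiplierFun (powerSymbol V θ t) v x • ζ i x) :=
      (stronglyMeasurable_multiplierFun hm w).sub
        ((stronglyMeasurable_multiplierFun hm v).smul
          ((ζ i).continuous.stronglyMeasurable.comp_measurable measurable_snd))
    refine (eLpNorm_le_lintegral_eLpNorm (ν := volume.restrict (Set.Ioi (0 : ℝ))) hp1 hp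
      (H := fun t x => ‖multiplierFun (powerSymbol V θ t) w x -
        multiplierFun (powerSymbol V θ t) v x • ζ i x‖ₑ)
      (u.memLp p volume) hmeas.enorm fun x => ?_).trans ?_
    · have h1 : u x = ∫ t in Set.Ioi 0, (multiplierFun (powerSymbol V θ t) w x -
          multiplierFun (powerSymbol V θ t) v x • ζ i x) := by
        rw [integral_sub (integrable_multiplierFun hm w (lintegral_powerSymbol_le hθ) x)
          ((integrable_multiplierFun hm v (lintegral_powerSymbol_le hθ) x).smul_const _),
          integral_smul_const, ← hrep, ← hrep, ← hgv, hu, sub_apply,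
          smulSchwartz_apply]
      rw [h1]
      exact enorm_integral_le_lintegral_enorm _
    · calc _ ≤ ∫⁻ t in Set.Ioi (0 : ℝ), ‖c‖ₑ * D *
            ENNReal.ofReal (t ^ θ * (1 + t) ^ (-1 - (1 + θ) / 2)) * eLpNorm g p volume := by
            refine setLIntegral_mono' measurableSet_Ioi fun t ht => ?_
            have ht0 : (0 : ℝ) < t := ht
            have h2 : (fun x => ‖multiplierFun (powerSymbol V θ t) w x -
                  multiplierFun (powerSymbol V θ t) v x • ζ i x‖ₑ) =
                fun x => ‖(((c * t ^ θ : ℝ) : ℂ) • (smulSchwartz (resolvent ℂ t v) (ζ i) -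
                  resolvent (F i) t w) : 𝓢(V, F i)) x‖ₑ := by
              ext x
              simp only [multiplierFun_powerSymbol θ ht0, smul_apply, sub_apply,
                smulSchwartz_apply, hw, ← hc]
              congr 1
              module
            refine (congrArg (fun f => eLpNorm f p volume) h2).trans_le ?_
            rw [eLpNorm_enorm, eLpNorm_schwartz_smul]
            refine (mul_le_mul_right (hD t ht0.le i g) _).trans_eq ?_
            rw [← ofReal_norm, Complex.norm_real, norm_mul, ENNReal.ofReal_mul (norm_nonneg _),
              ofReal_norm, Real.norm_of_nonneg (by positivity), ENNReal.ofReal_mul (by positivity)]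
            ring
        _ = _ := by
            rw [lintegral_mul_const' _ _ (g.eLpNorm_lt_top p volume).ne,
              lintegral_const_mul' _ _ (by simp [ENNReal.mul_eq_top])]
  have hsum : bessel (F i) (2 * θ) w = u + smulSchwartz g (ζ i) := by rw [hu, sub_add_cancel]
  rw [hsum]
  refine (eLpNorm_schwartz_add_le hp1 _ _).trans ?_
  have h3 := eLpNorm_smulSchwartz_le (p := p) (g := g) (hB i)
  rw [ENNReal.ofReal_coe_nnreal] at h3
  refine (add_le_add hmain h3).trans_eq ?_
  rw [ENNReal.coe_add, ENNReal.coe_mul, ENNReal.coe_mul, ENNReal.coe_toNNReal hLtop, add_mul,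
    add_comm, enorm_eq_nnnorm]

/-- The derivatives that fall on `J ^ (-(a + 2)) g` in the product rule are absorbed by
`J ^ (-2)`. -/
theorem BesselStable.add_two (hp1 : 1 ≤ p) (hp : p ≠ ⊤) {a : ℝ} (h : BesselStable V p a) :
    BesselStable V p (a + 2) := by
  intro I F _ _ _ ζ hζ
  obtain ⟨K, hK⟩ := exists_bessel_neg_two_bound V hp1 hp
  choose K1 hK1 using fun j => exists_lineDeriv_bessel_neg_two_bound (V := V) hp1 hp (onb V j)
  obtain ⟨C0, hC0⟩ := h I F ζ hζ
  choose C1 hC1 using fun j => h I F _ (hζ.lineDeriv (onb V j))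
  choose C2 hC2 using fun j => h I F _ ((hζ.lineDeriv (onb V j)).lineDeriv (onb V j))
  refine ⟨C0 + ‖lapConst‖₊ * ∑ j, (2 * (C1 j * K1 j) + C2 j * K), fun i g => ?_⟩
  set r := bessel ℂ (-2) g with hr
  have hu : bessel ℂ (-(a + 2)) g = bessel ℂ (-a) r := by
    rw [hr, bessel_bessel]; congr 2; ring
  have hu2 : bessel ℂ 2 (bessel ℂ (-a) r) = bessel ℂ (-a) g := by
    rw [hr, bessel_bessel, bessel_bessel]; congr 2; ring
  rw [hu, ← bessel_bessel, bessel_two_smulSchwartz, hu2, map_sub, map_smul, map_sum]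
  simp only [map_add, map_smul, lineDeriv_bessel]
  refine (eLpNorm_schwartz_sub_le hp1 _ _).trans ?_
  rw [eLpNorm_schwartz_smul, ENNReal.coe_add, add_mul, ENNReal.coe_mul, ENNReal.ofNNReal_finsetSum,
    mul_assoc, Finset.sum_mul, enorm_eq_nnnorm]
  gcongr
  · exact hC0 i g
  refine (eLpNorm_schwartz_sum_le hp1 _ _).trans (Finset.sum_le_sum fun j _ => ?_)
  refine (eLpNorm_schwartz_add_le hp1 _ _).trans ?_
  have h5 : ‖(2 : ℂ)‖ₑ = 2 := by simp [← ofReal_norm]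
  rw [eLpNorm_schwartz_smul, h5]
  have e1 := (hC1 j i (∂_{onb V j} r)).trans (mul_le_mul_right (hK1 j ℂ g) _)
  have e2 := (hC2 j i r).trans (mul_le_mul_right (hK ℂ g) _)
  refine (add_le_add (mul_le_mul_right e1 _) e2).trans_eq ?_
  push_cast
  ring

/-- The product rule is used in divergence form, so that its derivatives are absorbed by the outer
`J ^ (-2)`. -/
theorem BesselStable.sub_two (hp1 : 1 ≤ p) (hp : p ≠ ⊤) {a : ℝ} (h : BesselStable V p a) :
    BesselStable V p (a - 2) := by
  intro I F _ _ _ ζ hζ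
  obtain ⟨K, hK⟩ := exists_bessel_neg_two_bound V hp1 hp
  choose K1 hK1 using fun j => exists_lineDeriv_bessel_neg_two_bound (V := V) hp1 hp (onb V j)
  obtain ⟨C0, hC0⟩ := h I F ζ hζ
  choose C1 hC1 using fun j => h I F _ (hζ.lineDeriv (onb V j))
  choose C2 hC2 using fun j => h I F _ ((hζ.lineDeriv (onb V j)).lineDeriv (onb V j))
  refine ⟨C0 + ‖lapConst‖₊ * ∑ j, (2 * (K1 j * C1 j) + K * C2 j), fun i g => ?_⟩
  set w := bessel ℂ (-a) g with hw
  have hu : bessel ℂ (-(a - 2)) g = bessel ℂ 2 w := by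
    rw [hw, bessel_bessel]; congr 2; ring
  -- the derivatives of `w` in the commutator are moved outside by the product rule
  have hprod : smulSchwartz (bessel ℂ 2 w) (ζ i) = bessel (F i) 2 (smulSchwartz w (ζ i)) +
      lapConst • ∑ j, ((2 : ℂ) • (∂_{onb V j} (smulSchwartz w (∂_{onb V j} (ζ i)))) -
        smulSchwartz w (∂_{onb V j} (∂_{onb V j} (ζ i)))) := by
    rw [bessel_two_smulSchwartz]
    simp only [lineDeriv_smulSchwartz]
    rw [sub_add, ← smul_sub, ← Finset.sum_sub_distrib, eq_comm, sub_eq_self,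
      Finset.sum_eq_zero, smul_zero]
    intro j _
    module
  have hsplit (f : 𝓢(V, F i)) : bessel (F i) (a - 2) f = bessel (F i) (-2) (bessel (F i) a f) := by
    rw [bessel_bessel]; congr 2; ring
  have hback (f : 𝓢(V, F i)) : bessel (F i) (a - 2) (bessel (F i) 2 f) = bessel (F i) a f := by
    rw [bessel_bessel, sub_add_cancel]
  rw [hu, hprod, map_add, hback, map_smul, map_sum]
  simp only [map_sub, map_smul]
  refine (eLpNorm_schwartz_add_le hp1 _ _).trans ?_
  rw [eLpNorm_schwartz_smul, ENNReal.coe_add, add_mul, ENNReal.coe_mul, ENNReal.ofNNReal_finsetSum,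
    mul_assoc, Finset.sum_mul, enorm_eq_nnnorm]
  gcongr
  · exact hC0 i g
  refine (eLpNorm_schwartz_sum_le hp1 _ _).trans (Finset.sum_le_sum fun j _ => ?_)
  refine (eLpNorm_schwartz_sub_le hp1 _ _).trans ?_
  have h5 : ‖(2 : ℂ)‖ₑ = 2 := by simp [← ofReal_norm]
  rw [eLpNorm_schwartz_smul, h5, ← lineDeriv_bessel, hsplit, hsplit]
  have e1 := (hK1 j (F i) (bessel (F i) a (smulSchwartz w (∂_{onb V j} (ζ i))))).trans
    (mul_le_mul_right (hC1 j i g) _)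
  have e2 := (hK (F i) (bessel (F i) a (smulSchwartz w (∂_{onb V j} (∂_{onb V j} (ζ i)))))).trans
    (mul_le_mul_right (hC2 j i g) _)
  refine (add_le_add (mul_le_mul_right e1 _) e2).trans_eq ?_
  push_cast
  ring

theorem besselStable (hp1 : 1 ≤ p) (hp : p ≠ ⊤) (a : ℝ) : BesselStable V p a := by
  -- the order is `a = 2 fract (a / 2) + 2 ⌊a / 2⌋`
  have hbase : BesselStable V p (2 * Int.fract (a / 2)) := by
    rcases (Int.fract_nonneg (a / 2)).eq_or_lt with h | h
    · rw [← h, mul_zero]; exact besselStable_zero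
    · exact besselStable_of_pos_of_lt_two hp1 hp h (Int.fract_lt_one _)
  have hint (m : ℤ) : BesselStable V p (2 * Int.fract (a / 2) + 2 * m) := by
    induction m using Int.induction_on with
    | zero => simpa using hbase
    | succ k ih =>
      have := BesselStable.add_two hp1 hp ih
      convert this using 1
      push_cast; ring
    | pred k ih =>
      have := BesselStable.sub_two hp1 hp ih
      convert this using 1
      push_cast; ring
  have h := hint ⌊a / 2⌋
  have e : 2 * Int.fract (a / 2) + 2 * (⌊a / 2⌋ : ℝ) = a := by
    rw [← mul_add, Int.fract_add_floor]; ring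
  rw [e] at h
  exact h

end SobolevMultiplier

namespace SobolevMultiplier

open FourierTransform Function

/-! ### Square functions of translates with bounded overlap -/

section packet

variable {V : Type*} [NormedAddCommGroup V] [InnerProductSpace ℝ V]
  {F : Type*} [NormedAddCommGroup F] [NormedSpace ℂ F]

/-- A sum of translates of `χ`, placed into the target by contractions, has derivatives bounded by
those of `χ` times the overlap number of the supports. -/
theorem norm_iteratedFDeriv_sum_translate_le {ι : Type*} [Fintype ι] {E : ι → ℂ →L[ℂ] F}
    (hE : ∀ j, ‖E j‖ ≤ 1) {χ : 𝓢(V, ℂ)} {R : ℝ} (hχ : tsupport χ ⊆ Metric.closedBall 0 R)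
    {y : ι → V} {M : ℕ} {x : V}
    (hM : (Finset.univ.filter fun j => ‖x - y j‖ ≤ R).card ≤ M) (k : ℕ) :
    ‖iteratedFDeriv ℝ k
      (∑ j, (χ.compSubConstCLM ℂ (y j)).postcompCLM (E j) : 𝓢(V, F)) x‖ ≤
      M * SchwartzMap.seminorm ℂ 0 k χ := by
  have h1 : ((∑ j, (χ.compSubConstCLM ℂ (y j)).postcompCLM (E j) : 𝓢(V, F)) : V → F) =
      fun z => ∑ j, E j (χ (z - y j)) := by
    ext z; simp
  have hs (j) : ContDiff ℝ k fun z => χ (z - y j) :=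
    (χ.smooth k).comp (contDiff_id.sub contDiff_const)
  have hsE (j) : ContDiff ℝ k fun z => E j (χ (z - y j)) :=
    ((E j).restrictScalars ℝ).contDiff.comp (hs j)
  have hterm (j) : ‖iteratedFDeriv ℝ k (fun z => E j (χ (z - y j))) x‖ ≤
      ‖iteratedFDeriv ℝ k χ (x - y j)‖ := by
    have := ((E j).restrictScalars ℝ).norm_iteratedFDeriv_comp_left (hs j).contDiffAt
      (x := x) le_rfl
    rw [iteratedFDeriv_comp_sub] at this
    refine this.trans ((mul_le_mul_of_nonneg_right ?_ (norm_nonneg _)).trans_eq (one_mul _))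
    rw [ContinuousLinearMap.norm_restrictScalars]
    exact hE j
  rw [h1, iteratedFDeriv_fun_sum_apply fun j _ => (hsE j).contDiffAt]
  refine (norm_sum_le _ _).trans ((Finset.sum_le_sum fun j _ => hterm j).trans ?_)
  rw [← Finset.sum_filter_of_ne (p := fun j => ‖x - y j‖ ≤ R)]
  · refine (Finset.sum_le_card_nsmul _ _ (SchwartzMap.seminorm ℂ 0 k χ) fun j _ =>
      χ.norm_iteratedFDeriv_le_seminorm ℂ k _).trans ?_
    rw [nsmul_eq_mul]
    gcongr
  · intro j _ hj
    have h2 : x - y j ∈ tsupport χ := support_iteratedFDeriv_subset k (norm_ne_zero_iff.1 hj)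
    simpa using hχ h2

end packet

variable {V : Type*} [NormedAddCommGroup V] [InnerProductSpace ℝ V] [FiniteDimensional ℝ V]
  [MeasurableSpace V] [BorelSpace V]

theorem bessel_postcompCLM {F G : Type*} [NormedAddCommGroup F] [NormedSpace ℂ F] [CompleteSpace F]
    [NormedAddCommGroup G] [NormedSpace ℂ G] [CompleteSpace G] (L : F →L[ℂ] G) (a : ℝ)
    (f : 𝓢(V, F)) : bessel G a (f.postcompCLM L) = (bessel F a f).postcompCLM L := by
  have hchar (c : Circle) (w : F) : c • L w = L (c • w) := by
    rw [Circle.smul_def, Circle.smul_def, map_smul]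
  have hF (ξ : V) : 𝓕 (f.postcompCLM L) ξ = L (𝓕 f ξ) := by
    rw [SchwartzMap.fourier_coe, SchwartzMap.fourier_coe, Real.fourier_eq, Real.fourier_eq,
      ← L.integral_comp_comm (μ := (volume : Measure V))]
    · simp only [SchwartzMap.postcompCLM_apply, hchar]
    · exact (Real.fourierIntegral_convergent_iff ξ).2 (f.integrable (μ := volume))
  have hm := hasTemperateGrowth_bessel (V := V) a
  ext x
  rw [SchwartzMap.postcompCLM_apply, bessel, bessel, ← multiplierFun_eq hm, ← multiplierFun_eq hm]
  unfold multiplierFun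
  rw [Real.fourierInv_eq, Real.fourierInv_eq, ← L.integral_comp_comm]
  · simp only [hF, ← map_smul, hchar]
  · have h2 := (Real.fourierIntegral_convergent_iff (-x)).2 <|
      (SchwartzMap.smulLeftCLM F (fun ξ : V => (((1 + ‖ξ‖ ^ 2) ^ (a / 2) : ℝ) : ℂ))
        (𝓕 f)).integrable (μ := volume)
    simpa [SchwartzMap.smulLeftCLM_apply_apply hm] using h2

theorem sum_eLpNorm_rpow_eq {ι : Type*} [Fintype ι] {q : ℝ≥0∞} [Fact (1 ≤ q)] (hq : q ≠ ⊤)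
    (f : V → PiLp q fun _ : ι => ℂ) (hf : Continuous f) :
    ∑ j, eLpNorm (fun x => f x j) q volume ^ q.toReal = eLpNorm f q volume ^ q.toReal := by
  have hq0 : q ≠ 0 := (zero_lt_one.trans_le (Fact.out : 1 ≤ q)).ne'
  have hQ : 0 < q.toReal := ENNReal.toReal_pos hq0 hq
  simp only [eLpNorm_eq_lintegral_rpow_enorm_toReal hq0 hq]
  simp only [one_div, ENNReal.rpow_inv_rpow hQ.ne']
  rw [← lintegral_finsetSum']
  · refine lintegral_congr fun x => ?_
    rw [← ofReal_norm (f x), PiLp.norm_eq_sum hQ, one_div, ENNReal.ofReal_rpow_of_nonneg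
      (by positivity) hQ.le, Real.rpow_inv_rpow (by positivity) hQ.ne',
      ENNReal.ofReal_sum_of_nonneg (fun _ _ => by positivity)]
    refine Finset.sum_congr rfl fun j _ => ?_
    rw [← ofReal_norm, ENNReal.ofReal_rpow_of_nonneg (norm_nonneg _) hQ.le]
  · intro j _
    have : Continuous fun x => f x j := by fun_prop
    exact (this.enorm.measurable.pow_const _).aemeasurable

/-- The `ℓ^q` sum of the Bessel potential norms of the pieces of a function cut by translates of a
bump with bounded overlap is controlled by the norm of the function. -/
theorem exists_sum_bessel_translate_le {q : ℝ≥0∞} (hq1 : 1 ≤ q) (hq : q ≠ ⊤) (a : ℝ) {χ : 𝓢(V, ℂ)}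
    {R : ℝ} (hχ : tsupport χ ⊆ Metric.closedBall 0 R) {J : Type} {y : J → V} {M : ℕ}
    (hM : ∀ (x : V) (S : Finset J), (S.filter fun j => ‖x - y j‖ ≤ R).card ≤ M) :
    ∃ C : ℝ≥0, ∀ (S : Finset J) (g : 𝓢(V, ℂ)),
      (∑ j ∈ S, eLpNorm (bessel ℂ a (smulSchwartz g (χ.compSubConstCLM ℂ (y j)))) q volume ^
        q.toReal) ^ (1 / q.toReal) ≤ C * eLpNorm (bessel ℂ a g) q volume := by
  classical
  have : Fact (1 ≤ q) := ⟨hq1⟩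
  have hQ : 0 < q.toReal := ENNReal.toReal_pos (zero_lt_one.trans_le hq1).ne' hq
  -- all pieces are treated at once, as the components of a function with values in `ℓ^q(S)`
  let F : Finset J → Type := fun S => PiLp q fun _ : S => ℂ
  let E (S : Finset J) (j : S) : ℂ →L[ℂ] F S :=
    ContinuousLinearMap.toSpanSingleton ℂ (PiLp.single q j (1 : ℂ) : PiLp q fun _ : S => ℂ)
  let ζ (S : Finset J) : 𝓢(V, F S) := ∑ j : S, (χ.compSubConstCLM ℂ (y j)).postcompCLM (E S j)
  have hζ : UniformlySmooth ζ := by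
    intro k
    refine ⟨M * SchwartzMap.seminorm ℂ 0 k χ, fun S x => ?_⟩
    refine norm_iteratedFDeriv_sum_translate_le (fun j => ?_) hχ ?_ k
    · refine (ContinuousLinearMap.norm_toSpanSingleton _).trans_le ?_
      exact (PiLp.norm_single (p := q) (β := fun _ : S => ℂ) j (1 : ℂ)).trans_le norm_one.le
    refine le_trans ?_ (hM x S)
    refine Finset.card_le_card_of_injOn Subtype.val ?_ Subtype.val_injective.injOn
    intro j hj
    simpa using hj
  obtain ⟨C, hC⟩ := besselStable (V := V) hq1 hq a (Finset J) F ζ hζ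
  refine ⟨C, fun S g => ?_⟩
  have h1 := hC S (bessel ℂ a g)
  rw [bessel_bessel, neg_add_cancel, bessel_zero] at h1
  let P (j : S) : F S →L[ℂ] ℂ := PiLp.proj q (fun _ : S => ℂ) j
  have hP (j i : S) : P j (PiLp.single q i (1 : ℂ)) = if i = j then 1 else 0 := by
    refine (PiLp.proj_apply ..).trans ?_
    rw [PiLp.single_apply]
    simp only [eq_comm]
  have h2 (j : S) : smulSchwartz g (χ.compSubConstCLM ℂ (y j)) =
      (smulSchwartz g (ζ S)).postcompCLM (P j) := by
    ext x
    rw [SchwartzMap.postcompCLM_apply, smulSchwartz_apply, smulSchwartz_apply, map_smul]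
    congr 1
    simp only [ζ, E, sum_apply, map_sum, SchwartzMap.postcompCLM_apply]
    rw [Finset.sum_eq_single j]
    · rw [ContinuousLinearMap.toSpanSingleton_apply, map_smul, hP, if_pos rfl, smul_eq_mul, mul_one]
    · intro i _ hij
      rw [ContinuousLinearMap.toSpanSingleton_apply, map_smul, hP, if_neg hij, smul_zero]
    · simp
  have h3 := sum_eLpNorm_rpow_eq hq (bessel (F S) a (smulSchwartz g (ζ S)))
    (bessel (F S) a (smulSchwartz g (ζ S))).continuous
  rw [← Finset.sum_coe_sort]
  simp only [h2, bessel_postcompCLM]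
  refine (congrArg (fun t => t ^ (1 / q.toReal)) h3).trans_le ?_
  rw [one_div, ENNReal.rpow_rpow_inv hQ.ne']
  exact h1

/-- Multiplication by the translates of a Schwartz function is bounded in the Bessel potential norm,
uniformly over the translates. -/
theorem exists_bessel_translate_le {W : Type} [NormedAddCommGroup W] [InnerProductSpace ℝ W]
    [FiniteDimensional ℝ W] [MeasurableSpace W] [BorelSpace W] {q : ℝ≥0∞} (hq1 : 1 ≤ q)
    (hq : q ≠ ⊤) (a : ℝ) (χ : 𝓢(W, ℂ)) :
    ∃ C : ℝ≥0, ∀ (z : W) (g : 𝓢(W, ℂ)),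
      eLpNorm (bessel ℂ a (smulSchwartz g (χ.compSubConstCLM ℂ z))) q volume ≤
        C * eLpNorm (bessel ℂ a g) q volume := by
  have hζ : UniformlySmooth fun z : W => χ.compSubConstCLM ℂ z := by
    intro k
    refine ⟨SchwartzMap.seminorm ℂ 0 k χ, fun z x => ?_⟩
    have h1 : (χ.compSubConstCLM ℂ z : W → ℂ) = fun x => χ (x - z) := rfl
    rw [h1, iteratedFDeriv_comp_sub]
    exact χ.norm_iteratedFDeriv_le_seminorm ℂ k _
  obtain ⟨C, hC⟩ := besselStable (V := W) hq1 hq a W (fun _ => ℂ) _ hζ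
  refine ⟨C, fun z g => ?_⟩
  have h1 := hC z (bessel ℂ a g)
  rwa [bessel_bessel, neg_add_cancel, bessel_zero] at h1

end SobolevMultiplier

namespace SobolevMultiplier

/-! ### A smooth partition of unity by translates along a lattice -/

/-- A smooth function on the line supported in `[-1, 1]` whose integer translates sum to one. -/
def unitBump (t : ℝ) : ℝ := Real.smoothTransition (t + 1) - Real.smoothTransition t

theorem contDiff_unitBump : ContDiff ℝ (⊤ : ℕ∞) unitBump :=
  (Real.smoothTransition.contDiff.comp (contDiff_id.add contDiff_const)).sub
    Real.smoothTransition.contDiff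

theorem unitBump_eq_zero {t : ℝ} (ht : 1 < |t|) : unitBump t = 0 := by
  unfold unitBump
  rcases lt_abs.1 ht with h | h
  · rw [Real.smoothTransition.one_of_one_le (by linarith),
      Real.smoothTransition.one_of_one_le h.le, sub_self]
  · rw [Real.smoothTransition.zero_of_nonpos (by linarith),
      Real.smoothTransition.zero_of_nonpos (by linarith), sub_self]

/-- The integers from `-N` to `N`. -/
def intBox (N : ℕ) : Finset ℤ :=
  (Finset.range (2 * N + 1)).map (Nat.castEmbedding.trans (Equiv.subRight (N : ℤ)).toEmbedding)

theorem sum_intBox_unitBump {N : ℕ} {t : ℝ} (ht : |t| ≤ N) :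
    ∑ k ∈ intBox N, unitBump (t - k) = 1 := by
  rw [intBox, Finset.sum_map]
  have h := Finset.sum_range_sub' (fun k : ℕ => Real.smoothTransition (t - k + N + 1)) (2 * N + 1)
  obtain ⟨h1, h2⟩ := abs_le.1 ht
  rw [Real.smoothTransition.one_of_one_le (by push_cast; linarith),
    Real.smoothTransition.zero_of_nonpos (x := t - (2 * N + 1 : ℕ) + N + 1)
      (by push_cast; linarith), sub_zero] at h
  rw [← h]
  refine Finset.sum_congr rfl fun k _ => ?_
  have hk : (((Nat.castEmbedding.trans (Equiv.subRight (N : ℤ)).toEmbedding) k : ℤ) : ℝ) =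
      k - N := Int.cast_sub _ _
  rw [hk, unitBump]
  push_cast
  congr 2 <;> ring

theorem norm_le_one_of_abs_le {n : ℕ} {x : Space n} (hx : ∀ i, |x i * n| ≤ 1) : ‖x‖ ≤ 1 := by
  rcases Nat.eq_zero_or_pos n with rfl | hn
  · rw [Subsingleton.elim x 0, norm_zero]; exact zero_le_one
  have hn' : (1 : ℝ) ≤ n := by exact_mod_cast hn
  rw [EuclideanSpace.norm_eq, Real.sqrt_le_one]
  have hb (i) : ‖x i‖ ^ 2 ≤ (n : ℝ)⁻¹ := by
    have h1 := hx i
    rw [abs_mul, Nat.abs_cast, ← le_div_iff₀ (by positivity), one_div] at h1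
    calc ‖x i‖ ^ 2 ≤ (n : ℝ)⁻¹ ^ 2 := by rw [Real.norm_eq_abs]; gcongr
      _ ≤ (n : ℝ)⁻¹ ^ 1 := pow_le_pow_of_le_one (by positivity)
        (inv_le_one_of_one_le₀ hn') one_le_two
      _ = _ := pow_one _
  refine (Finset.sum_le_sum fun i _ => hb i).trans ?_
  rw [Finset.sum_const, Finset.card_univ, Fintype.card_fin, nsmul_eq_mul,
    mul_inv_cancel₀ (by positivity)]

/-- The tensor product of rescaled unit bumps. -/
def latticeBumpFun (n : ℕ) (x : Space n) : ℂ := ((∏ i, unitBump (x i * n) : ℝ) : ℂ)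

theorem support_latticeBumpFun_subset (n : ℕ) :
    Function.support (latticeBumpFun n) ⊆ Metric.closedBall 0 1 := by
  intro x hx
  rw [mem_closedBall_zero_iff]
  refine norm_le_one_of_abs_le fun i => ?_
  by_contra! h
  exact hx (by
    rw [latticeBumpFun, Finset.prod_eq_zero (Finset.mem_univ i) (unitBump_eq_zero h),
      Complex.ofReal_zero])

/-- The test function whose translates along the lattice `n⁻¹ ℤⁿ` form a partition of unity. The
mesh `n⁻¹` makes its support fit into the unit ball. -/
def latticeBump (n : ℕ) : TestFn n where
  toFun := latticeBumpFun n
  contDiff' := by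
    have h : ContDiff ℝ (⊤ : ℕ∞) fun x : Space n => ∏ i, unitBump (x i * n) :=
      contDiff_prod fun i _ => contDiff_unitBump.comp
        ((contDiff_piLp_apply (p := 2)).mul contDiff_const)
    exact Complex.ofRealCLM.contDiff.comp h
  hasCompactSupport' := HasCompactSupport.of_support_subset_isCompact
    (isCompact_closedBall 0 1) (support_latticeBumpFun_subset n)
  tsupport_subset' := fun _ _ => trivial

theorem tsupport_latticeBump_subset (n : ℕ) :
    tsupport (latticeBump n) ⊆ Metric.closedBall 0 1 :=
  closure_minimal (support_latticeBumpFun_subset n) Metric.isClosed_closedBall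

/-- The points of the lattice `n⁻¹ ℤⁿ`. -/
def latticePoint (n : ℕ) (z : Fin n → ℤ) : Space n := WithLp.toLp 2 fun i => (z i : ℝ) / n

theorem exists_sum_latticeBump_eq_one {n : ℕ} (hn : 1 ≤ n) (r : ℝ) :
    ∃ S : Finset (Fin n → ℤ), ∀ x : Space n, ‖x‖ ≤ r →
      ∑ z ∈ S, latticeBump n (x - latticePoint n z) = 1 := by
  have hn' : (0 : ℝ) < n := by exact_mod_cast hn
  obtain ⟨N, hN⟩ := exists_nat_ge (r * n)
  refine ⟨Fintype.piFinset fun _ => intBox N, fun x hx => ?_⟩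
  have h1 (i : Fin n) : ∑ k ∈ intBox N, unitBump (x i * n - k) = 1 := by
    refine sum_intBox_unitBump ?_
    rw [abs_mul, Nat.abs_cast]
    refine le_trans ?_ hN
    gcongr
    exact (PiLp.norm_apply_le x i).trans hx
  have h2 := Finset.prod_univ_sum (fun _ : Fin n => intBox N) fun i k => unitBump (x i * n - k)
  simp only [h1, Finset.prod_const_one] at h2
  have h3 (z : Fin n → ℤ) : latticeBump n (x - latticePoint n z) =
      ((∏ i, unitBump (x i * n - z i) : ℝ) : ℂ) := by
    change latticeBumpFun n _ = _
    rw [latticeBumpFun]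
    congr 1
    refine Finset.prod_congr rfl fun i _ => ?_
    rw [PiLp.sub_apply, latticePoint]
    congr 1
    field_simp
  simp only [h3]
  rw [← Complex.ofReal_sum, ← h2, Complex.ofReal_one]

theorem exists_latticePoint_overlap {n : ℕ} (hn : 1 ≤ n) (R : ℝ) :
    ∃ M : ℕ, ∀ (x : Space n) (S : Finset (Fin n → ℤ)),
      (S.filter fun z => ‖x - latticePoint n z‖ ≤ R).card ≤ M := by
  have hn' : (0 : ℝ) < n := by exact_mod_cast hn
  refine ⟨⌊2 * R * n + 1⌋.toNat ^ n, fun x S => ?_⟩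
  have h1 : (S.filter fun z => ‖x - latticePoint n z‖ ≤ R) ⊆
      Fintype.piFinset fun i => Finset.Icc ⌈(x i - R) * n⌉ ⌊(x i + R) * n⌋ := by
    intro z hz
    rw [Fintype.mem_piFinset]
    intro i
    have h2 := (PiLp.norm_apply_le (x - latticePoint n z) i).trans (Finset.mem_filter.1 hz).2
    have h3 : (x - latticePoint n z) i = x i - z i / n := rfl
    rw [h3, Real.norm_eq_abs, abs_le] at h2
    have h4 : (z i : ℝ) / n * n = z i := div_mul_cancel₀ _ hn'.ne'
    rw [Finset.mem_Icc, Int.ceil_le, Int.le_floor, ← h4]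
    constructor <;> gcongr <;> linarith
  refine (Finset.card_le_card h1).trans ?_
  rw [Fintype.card_piFinset]
  refine (Finset.prod_le_pow_card _ _ ⌊2 * R * n + 1⌋.toNat fun i _ => ?_).trans_eq (by simp)
  rw [Int.card_Icc]
  refine Int.toNat_le_toNat ?_
  rw [Int.le_floor]
  push_cast
  have h5 := Int.floor_le ((x i + R) * n)
  have h6 := Int.le_ceil ((x i - R) * n)
  linarith

end SobolevMultiplier

namespace SobolevMultiplier

open Filter Topology

/-! ### Density of test functions in the Schwartz space -/

variable {n : ℕ}

/-- The product of a Schwartz function with the dilate `χ (c ·)` of a test function. -/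
def cutoff (χ : TestFn n) (h : 𝓢(Space n, ℂ)) {c : ℝ} (hc : c ≠ 0) : TestFn n where
  toFun x := χ (c • x) * h x
  contDiff' := (χ.contDiff.comp (contDiff_const_smul c)).mul (h.smooth ⊤)
  hasCompactSupport' := by
    have h1 : HasCompactSupport fun x => χ (c • x) :=
      χ.hasCompactSupport.comp_homeomorph (Homeomorph.smulOfNeZero c hc)
    exact h1.mul_right
  tsupport_subset' := fun _ _ => trivial

theorem norm_iteratedFDeriv_cutoff_le (χ : TestFn n) (h : 𝓢(Space n, ℂ)) {c : ℝ} (hc : c ≠ 0)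
    (hc1 : |c| ≤ 1) (m : ℕ) (x : Space n) :
    ‖iteratedFDeriv ℝ m (cutoff χ h hc).toSchwartz x‖ ≤ ∑ i ∈ Finset.range (m + 1),
      m.choose i * SchwartzMap.seminorm ℂ 0 i χ.toSchwartz * ‖iteratedFDeriv ℝ (m - i) h x‖ := by
  have hχ : ContDiff ℝ m fun x : Space n => χ (c • x) :=
    (χ.toSchwartz.smooth m).comp (contDiff_const_smul c)
  refine (norm_iteratedFDeriv_mul_le hχ (h.smooth m) x le_rfl).trans ?_
  refine Finset.sum_le_sum fun i _ => ?_
  gcongr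
  change ‖iteratedFDeriv ℝ i (fun x => χ.toSchwartz (c • x)) x‖ ≤ _
  rw [iteratedFDeriv_comp_const_smul c (χ.toSchwartz.smooth i), norm_smul, norm_pow,
    Real.norm_eq_abs]
  refine (mul_le_of_le_one_left (norm_nonneg _) (pow_le_one₀ (abs_nonneg _) hc1)).trans ?_
  exact χ.toSchwartz.norm_iteratedFDeriv_le_seminorm ℂ i _

/-- The cutoffs of a Schwartz function by `χ (· / R)` converge to it at the rate `R⁻¹` in every
Schwartz seminorm, one power of `‖x‖ ≥ R` being traded for the factor `R⁻¹`. -/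
theorem exists_seminorm_cutoff_sub_le {χ : TestFn n} (hχ : ∀ x, ‖x‖ ≤ 1 → χ x = 1)
    (h : 𝓢(Space n, ℂ)) (k m : ℕ) :
    ∃ A : ℝ, ∀ (c : ℝ) (hc : 0 < c), c ≤ 1 →
      SchwartzMap.seminorm ℂ k m ((cutoff χ h hc.ne').toSchwartz - h) ≤ c * A := by
  set A : ℝ := ∑ i ∈ Finset.range (m + 1), m.choose i * SchwartzMap.seminorm ℂ 0 i χ.toSchwartz *
    SchwartzMap.seminorm ℂ (k + 1) (m - i) h + SchwartzMap.seminorm ℂ (k + 1) m h with hA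
  have hA0 : 0 ≤ A := by
    have := fun i => apply_nonneg (SchwartzMap.seminorm ℂ 0 i) χ.toSchwartz
    have := fun i => apply_nonneg (SchwartzMap.seminorm ℂ (k + 1) i) h
    rw [hA]
    refine add_nonneg (Finset.sum_nonneg fun i _ => ?_) (by simp)
    exact mul_nonneg (mul_nonneg (by positivity) (by simp)) (by simp)
  refine ⟨A, fun c hc hc1 => SchwartzMap.seminorm_le_bound ℂ k m _ (by positivity) fun x => ?_⟩
  rcases lt_or_ge ‖c • x‖ 1 with hx | hx
  · have h1 : (((cutoff χ h hc.ne').toSchwartz - h : 𝓢(Space n, ℂ)) : Space n → ℂ) =ᶠ[𝓝 x]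
        fun _ => 0 := by
      have : ∀ᶠ y in 𝓝 x, ‖c • y‖ < 1 :=
        (by fun_prop : Continuous fun y : Space n => ‖c • y‖).continuousAt.eventually_lt_const hx
      filter_upwards [this] with y hy
      change χ (c • y) * h y - h y = 0
      rw [hχ _ hy.le, one_mul, sub_self]
    rw [(h1.iteratedFDeriv ℝ m).eq_of_nhds, iteratedFDeriv_fun_zero]
    simp only [Pi.zero_apply, norm_zero, mul_zero]
    positivity
  · have hxk : ‖x‖ ^ k ≤ c * ‖x‖ ^ (k + 1) := by
      rw [norm_smul, Real.norm_of_nonneg hc.le] at hx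
      calc ‖x‖ ^ k ≤ ‖x‖ ^ k * (c * ‖x‖) := le_mul_of_one_le_right (by positivity) hx
        _ = _ := by ring
    have h2 : iteratedFDeriv ℝ m ((cutoff χ h hc.ne').toSchwartz - h : 𝓢(Space n, ℂ)) x =
        iteratedFDeriv ℝ m (cutoff χ h hc.ne').toSchwartz x - iteratedFDeriv ℝ m h x :=
      iteratedFDeriv_sub_apply ((cutoff χ h hc.ne').toSchwartz.smooth m).contDiffAt
        (h.smooth m).contDiffAt
    rw [h2]
    calc _ ≤ c * ‖x‖ ^ (k + 1) * (∑ i ∈ Finset.range (m + 1),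
          m.choose i * SchwartzMap.seminorm ℂ 0 i χ.toSchwartz * ‖iteratedFDeriv ℝ (m - i) h x‖ +
          ‖iteratedFDeriv ℝ m h x‖) := by
          gcongr
          exact (norm_sub_le _ _).trans (by
            gcongr
            exact norm_iteratedFDeriv_cutoff_le χ h hc.ne' (by rwa [abs_of_pos hc]) m x)
      _ = c * (∑ i ∈ Finset.range (m + 1), m.choose i * SchwartzMap.seminorm ℂ 0 i χ.toSchwartz *
          (‖x‖ ^ (k + 1) * ‖iteratedFDeriv ℝ (m - i) h x‖) +
          ‖x‖ ^ (k + 1) * ‖iteratedFDeriv ℝ m h x‖) := by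
          rw [mul_assoc, mul_add, Finset.mul_sum]
          congr 3
          ext i
          ring
      _ ≤ c * A := by
          rw [hA]
          gcongr
          · exact h.le_seminorm ℂ _ _ x
          · exact h.le_seminorm ℂ _ _ x

theorem exists_testFn_eq_one (n : ℕ) : ∃ χ : TestFn n, ∀ x, ‖x‖ ≤ 1 → χ x = 1 := by
  let b : ContDiffBump (0 : Space n) := ⟨1, 2, one_pos, one_lt_two⟩
  refine ⟨⟨fun x => (b x : ℂ), Complex.ofRealCLM.contDiff.comp b.contDiff,
    b.hasCompactSupport.comp_left Complex.ofReal_zero, fun _ _ => trivial⟩, fun x hx => ?_⟩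
  change ((b x : ℝ) : ℂ) = 1
  rw [b.one_of_mem_closedBall (mem_closedBall_zero_iff.2 hx), Complex.ofReal_one]

theorem denseRange_toSchwartz : DenseRange (TestFn.toSchwartz (n := n)) := by
  obtain ⟨χ, hχ⟩ := exists_testFn_eq_one n
  intro h
  have hpos (N : ℕ) : (0 : ℝ) < 1 / ((N : ℝ) + 1) := by positivity
  refine mem_closure_of_tendsto (f := fun N : ℕ => (cutoff χ h (hpos N).ne').toSchwartz)
    (b := atTop) ?_ (Eventually.of_forall fun N => ⟨_, rfl⟩)
  rw [(schwartz_withSeminorms ℂ (Space n) ℂ).tendsto_nhds]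
  rintro ⟨k, m⟩ ε hε
  obtain ⟨A, hA⟩ := exists_seminorm_cutoff_sub_le hχ h k m
  have hlim : Tendsto (fun N : ℕ => 1 / ((N : ℝ) + 1) * A) atTop (𝓝 0) := by
    simpa using tendsto_one_div_add_atTop_nhds_zero_nat.mul_const A
  filter_upwards [hlim.eventually_lt_const hε] with N hN
  refine lt_of_le_of_lt (hA _ (hpos N) ?_) hN
  rw [div_le_one (by positivity)]
  linarith [Nat.cast_nonneg (α := ℝ) N]

end SobolevMultiplier

namespace SobolevMultiplier

open FourierTransform

/-! ### Duality for Bessel potential norms -/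

section norming

variable {X : Type*} [MeasurableSpace X] {μ : Measure X} {p q : ℝ≥0∞}

/-- A function in `L_p` is normed by its pairings with `L_q`: the pairing with
`|f| ^ (p - 2) conj f` is `‖f‖_p ^ p`. -/
theorem eLpNorm_le_of_forall_integral_mul_le [hpq : p.HolderConjugate q] (hp1 : 1 < p) (hp : p ≠ ⊤)
    {f : X → ℂ} (hf : MemLp f p μ) {K : ℝ≥0∞}
    (h : ∀ g : X → ℂ, MemLp g q μ → ‖∫ x, g x * f x ∂μ‖ₑ ≤ K * eLpNorm g q μ) :
    eLpNorm f p μ ≤ K := by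
  have hp0 : p ≠ 0 := (zero_lt_one.trans hp1).ne'
  set P := p.toReal with hP
  have hP1 : 1 < P := by
    rw [hP, ← ENNReal.toReal_one]; exact (ENNReal.toReal_lt_toReal ENNReal.one_ne_top hp).2 hp1
  have hP0 : 0 < P := zero_lt_one.trans hP1
  have hqp : q * ENNReal.ofReal (P - 1) = p := by
    have hq : q ≠ ⊤ := ((ENNReal.HolderConjugate.lt_top_iff_one_lt q p).2 hp1).ne
    have hc := ENNReal.HolderConjugate.toReal_of_ne_top hp hq
    rw [← ENNReal.ofReal_toReal hq, ← ENNReal.ofReal_mul ENNReal.toReal_nonneg, mul_comm,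
      hc.sub_one_mul_conj, ENNReal.ofReal_toReal hp]
  set g : X → ℂ := fun x => ((‖f x‖ ^ (P - 2) : ℝ) : ℂ) * (starRingEnd ℂ) (f x) with hg
  have hgf (x) : g x * f x = ((‖f x‖ ^ P : ℝ) : ℂ) := by
    rw [hg]
    dsimp only
    rw [mul_assoc, Complex.conj_mul', ← Complex.ofReal_pow, ← Complex.ofReal_mul]
    congr 1
    rcases eq_or_ne (f x) 0 with h0 | h0
    · rw [h0, norm_zero, Real.zero_rpow hP0.ne', zero_pow two_ne_zero, mul_zero]
    · rw [← Real.rpow_natCast, ← Real.rpow_add (norm_pos_iff.2 h0)]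
      congr 1
      push_cast
      ring
  have hgn (x) : ‖g x‖ = ‖f x‖ ^ (P - 1) := by
    rw [hg]
    dsimp only
    rw [norm_mul, Complex.norm_real, RCLike.norm_conj, Real.norm_of_nonneg (by positivity)]
    rcases eq_or_ne (f x) 0 with h0 | h0
    · rw [h0, norm_zero, mul_zero, Real.zero_rpow (by linarith)]
    · nth_rewrite 2 [← Real.rpow_one ‖f x‖]
      rw [← Real.rpow_add (norm_pos_iff.2 h0)]
      congr 1
      ring
  have hgm : AEStronglyMeasurable g μ := by
    refine AEStronglyMeasurable.mul ?_ ?_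
    · exact (Complex.measurable_ofReal.comp_aemeasurable
        (hf.1.norm.aemeasurable.pow_const _)).aestronglyMeasurable
    · exact Complex.continuous_conj.comp_aestronglyMeasurable hf.1
  have hgq : eLpNorm g q μ = eLpNorm f p μ ^ (P - 1) := by
    rw [eLpNorm_congr_norm_ae (g := fun x => ‖f x‖ ^ (P - 1))]
    · rw [eLpNorm_norm_rpow _ (by linarith), hqp]
    · refine Filter.Eventually.of_forall fun x => ?_
      rw [hgn, Real.norm_of_nonneg (by positivity)]
  by_cases hN0 : eLpNorm f p μ = 0
  · rw [hN0]; exact zero_le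
  have hNt := hf.2.ne
  have hint : ‖∫ x, g x * f x ∂μ‖ₑ = eLpNorm f p μ ^ P := by
    simp only [hgf]
    rw [integral_complex_ofReal, ← ofReal_norm, Complex.norm_real,
      Real.norm_of_nonneg (integral_nonneg fun x => by positivity),
      ofReal_integral_eq_lintegral_ofReal (hf.integrable_norm_rpow hp0 hp)
        (Filter.Eventually.of_forall fun x => by positivity),
      eLpNorm_eq_lintegral_rpow_enorm_toReal hp0 hp, one_div, ENNReal.rpow_inv_rpow hP0.ne']
    refine lintegral_congr fun x => ?_
    rw [← ofReal_norm, ENNReal.ofReal_rpow_of_nonneg (norm_nonneg _) hP0.le]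
  have h1 := h g ⟨hgm, by rw [hgq]; exact ENNReal.rpow_lt_top_of_nonneg (by linarith) hNt⟩
  rw [hint, hgq] at h1
  have h2 : eLpNorm f p μ ^ P = eLpNorm f p μ * eLpNorm f p μ ^ (P - 1) := by
    nth_rewrite 2 [← ENNReal.rpow_one (eLpNorm f p μ)]
    rw [← ENNReal.rpow_add _ _ hN0 hNt, add_sub_cancel]
  rw [h2] at h1
  refine (ENNReal.mul_le_mul_iff_left ?_ ?_).1 h1
  · exact (ENNReal.rpow_pos (pos_iff_ne_zero.2 hN0) hNt).ne'
  · exact ENNReal.rpow_ne_top_of_nonneg (by linarith) hNt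

end norming

section

variable {V : Type*} [NormedAddCommGroup V] [InnerProductSpace ℝ V] [FiniteDimensional ℝ V]
  [MeasurableSpace V] [BorelSpace V]

theorem besselPotential_toTemperedDistributionCLM (s : ℝ) (f : 𝓢(V, ℂ)) :
    TemperedDistribution.besselPotential V ℂ s (f : 𝓢'(V, ℂ)) = (bessel ℂ s f : 𝓢(V, ℂ)) := by
  exact TemperedDistribution.fourierMultiplierCLM_toTemperedDistributionCLM_eq
    (hasTemperateGrowth_bessel s) f

/-- As the symbol is even, the roles of the Fourier transform and its inverse may be exchanged. -/
theorem fourier_bessel_symbol (s : ℝ) (h : 𝓢(V, ℂ)) :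
    𝓕 (SchwartzMap.smulLeftCLM ℂ (fun ξ : V => (((1 + ‖ξ‖ ^ 2) ^ (s / 2) : ℝ) : ℂ)) (𝓕⁻ h)) =
      bessel ℂ s h := by
  have hm := hasTemperateGrowth_bessel (V := V) s
  ext x
  rw [bessel, ← multiplierFun_eq hm, multiplierFun, Real.fourierInv_eq_fourier_comp_neg,
    SchwartzMap.fourier_coe]
  refine congrArg (fun F : V → ℂ => 𝓕 F x) (funext fun ξ => ?_)
  rw [SchwartzMap.smulLeftCLM_apply_apply hm, norm_neg, SchwartzMap.fourier_coe,
    SchwartzMap.fourierInv_coe, Real.fourierInv_eq_fourier_neg]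

theorem besselPotential_apply (s : ℝ) (T : 𝓢'(V, ℂ)) (h : 𝓢(V, ℂ)) :
    TemperedDistribution.besselPotential V ℂ s T h = T (bessel ℂ s h) := by
  rw [← fourier_bessel_symbol]
  rfl

end

variable {n : ℕ} {p : ℝ≥0∞} [Fact (1 ≤ p)] {a : ℝ}

theorem toTemperedDistribution_injective {f g : Lp ℂ p (volume : Measure (Space n))}
    (h : (f : 𝓢'(Space n, ℂ)) = g) : f = g :=
  LinearMap.ker_eq_bot.1 (Lp.ker_toTemperedDistributionCLM_eq_bot (F := ℂ)
    (μ := (volume : Measure (Space n))) (p := p)) h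

theorem temperedSobolevNorm_eq {T : 𝓢'(Space n, ℂ)} {f : Lp ℂ p (volume : Measure (Space n))}
    (h : TemperedDistribution.besselPotential (Space n) ℂ a T = f) :
    temperedSobolevNorm a p T = ‖f‖ₑ := by
  refine le_antisymm (iInf₂_le f h) (le_iInf₂ fun g hg => ?_)
  rw [toTemperedDistribution_injective (h.symm.trans hg)]

theorem TestFn.sobolevNorm_eq (φ : TestFn n) :
    φ.sobolevNorm a p = eLpNorm (bessel ℂ a φ.toSchwartz) p volume := by
  have h : TemperedDistribution.besselPotential (Space n) ℂ a (φ.toSchwartz : 𝓢'(Space n, ℂ)) =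
      ((bessel ℂ a φ.toSchwartz).toLp p : Lp ℂ p (volume : Measure (Space n))) := by
    rw [besselPotential_toTemperedDistributionCLM, Lp.toTemperedDistribution_toLp_eq]
  rw [TestFn.sobolevNorm, temperedSobolevNorm_eq h, Lp.enorm_def]
  exact eLpNorm_congr_ae (SchwartzMap.coeFn_toLp _ _ _)

theorem TestFn.sobolevNorm_ne_top (φ : TestFn n) : φ.sobolevNorm a p ≠ ⊤ := by
  rw [φ.sobolevNorm_eq]
  exact (SchwartzMap.eLpNorm_lt_top _ _ _).ne

/-- Test functions are dense in the Schwartz space. -/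
theorem IsRestriction.unique {T T' : 𝓢'(Space n, ℂ)} {u : Distr n} (h : IsRestriction T u)
    (h' : IsRestriction T' u) : T = T' := by
  have h1 : (T : 𝓢(Space n, ℂ) → ℂ) = T' :=
    denseRange_toSchwartz.equalizer (map_continuous T) (map_continuous T')
      (funext fun φ => (h φ).trans (h' φ).symm)
  exact DFunLike.coe_injective h1

theorem sobolevNorm_eq {T : 𝓢'(Space n, ℂ)} {u : Distr n} (hT : IsRestriction T u)
    {f : Lp ℂ p (volume : Measure (Space n))}
    (h : TemperedDistribution.besselPotential (Space n) ℂ a T = f) :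
    sobolevNorm a p u = ‖f‖ₑ := by
  rw [← temperedSobolevNorm_eq h]
  refine le_antisymm (iInf₂_le T hT) (le_iInf₂ fun T' hT' => ?_)
  rw [hT.unique hT']

theorem apply_eq_integral_bessel {T : 𝓢'(Space n, ℂ)} {f : Lp ℂ p (volume : Measure (Space n))}
    (h : TemperedDistribution.besselPotential (Space n) ℂ (-a) T = f) (g : 𝓢(Space n, ℂ)) :
    T g = ∫ x, bessel ℂ a g x * f x := by
  have h1 : T g = TemperedDistribution.besselPotential (Space n) ℂ (-a) T (bessel ℂ a g) := by
    rw [besselPotential_apply, bessel_bessel, neg_add_cancel, bessel_zero]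
  rw [h1, h, Lp.toTemperedDistribution_apply]
  rfl

variable {q : ℝ≥0∞} [hpq : p.HolderConjugate q]

/-- The pairing of `H_p^{-a}` with `H_q^a`. -/
theorem enorm_apply_le_sobolevNorm_mul {u : Distr n} (hu : MemSobolev (-a) p u) (φ : TestFn n) :
    ‖u φ‖ₑ ≤ sobolevNorm (-a) p u * eLpNorm (bessel ℂ a φ.toSchwartz) q volume := by
  obtain ⟨T, hT, f, hf⟩ := hu
  have hpq' : q.HolderConjugate p := hpq.symm
  rw [← hT φ, sobolevNorm_eq hT hf, apply_eq_integral_bessel hf, Lp.enorm_def, mul_comm]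
  refine (enorm_integral_le_lintegral_enorm _).trans ?_
  have h1 := eLpNorm_smul_le_mul_eLpNorm (p := q) (q := p) (r := 1) (μ := volume)
    (Lp.memLp f).1 (bessel ℂ a φ.toSchwartz).continuous.aestronglyMeasurable
  rw [eLpNorm_one_eq_lintegral_enorm] at h1
  exact h1

/-- The norm of `H_p^{-a}` is dual to that of `H_q^a`, and test functions suffice to compute it. -/
theorem sobolevNorm_le_of_forall_enorm_apply_le [Fact (1 ≤ q)] (hp1 : 1 < p) (hp : p ≠ ⊤)
    {u : Distr n}
    (hu : MemSobolev (-a) p u) {K : ℝ≥0}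
    (h : ∀ φ : TestFn n, ‖u φ‖ₑ ≤ K * eLpNorm (bessel ℂ a φ.toSchwartz) q volume) :
    sobolevNorm (-a) p u ≤ K := by
  obtain ⟨T, hT, f, hf⟩ := hu
  have hpq' : q.HolderConjugate p := hpq.symm
  have hq : q ≠ ⊤ := ((ENNReal.HolderConjugate.lt_top_iff_one_lt q p).2 hp1).ne
  have hnorm (g : 𝓢(Space n, ℂ)) : ‖SchwartzMap.toLpCLM ℂ ℂ q (volume : Measure (Space n)) g‖ₑ =
      eLpNorm g q volume := by
    rw [Lp.enorm_def]
    exact eLpNorm_congr_ae (SchwartzMap.coeFn_toLp _ _ _)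
  have h1 (g : 𝓢(Space n, ℂ)) : ‖T g‖ₑ ≤
      K * ‖SchwartzMap.toLpCLM ℂ ℂ q (volume : Measure (Space n)) (bessel ℂ a g)‖ₑ := by
    have hcl : IsClosed {g : 𝓢(Space n, ℂ) | ‖T g‖ₑ ≤
        K * ‖SchwartzMap.toLpCLM ℂ ℂ q (volume : Measure (Space n)) (bessel ℂ a g)‖ₑ} := by
      refine isClosed_le (map_continuous T).enorm ?_
      exact (ENNReal.continuous_const_mul ENNReal.coe_ne_top).comp
        ((SchwartzMap.toLpCLM ℂ ℂ q _).continuous.comp (bessel ℂ a).continuous).enorm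
    refine hcl.closure_subset_iff.2 ?_ (denseRange_toSchwartz g)
    rintro _ ⟨φ, rfl⟩
    rw [Set.mem_ofPred_eq, hnorm, hT φ]
    exact h φ
  have h2 (g : Lp ℂ q (volume : Measure (Space n))) : ‖∫ x, g x * f x‖ₑ ≤ K * ‖g‖ₑ := by
    have hcl : IsClosed {g : Lp ℂ q (volume : Measure (Space n)) |
        ‖(ContinuousLinearMap.mul ℂ ℂ).lpPairing volume q p g f‖ₑ ≤ K * ‖g‖ₑ} := by
      refine isClosed_le ?_ ((ENNReal.continuous_const_mul ENNReal.coe_ne_top).comp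
        continuous_enorm)
      exact (((ContinuousLinearMap.mul ℂ ℂ).lpPairing volume q p).flip f).continuous.enorm
    have h3 := hcl.closure_subset_iff.2 ?_
      (SchwartzMap.denseRange_toLpCLM (μ := (volume : Measure (Space n))) (F := ℂ) hq g)
    · rw [Set.mem_ofPred_eq, ContinuousLinearMap.lpPairing_eq_integral] at h3
      exact h3
    · rintro _ ⟨g, rfl⟩
      rw [Set.mem_ofPred_eq, ContinuousLinearMap.lpPairing_eq_integral]
      have h4 := h1 (bessel ℂ (-a) g)
      rw [apply_eq_integral_bessel hf, bessel_bessel, add_neg_cancel, bessel_zero] at h4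
      refine le_trans (le_of_eq ?_) h4
      congr 1
      refine integral_congr_ae ?_
      filter_upwards [SchwartzMap.coeFn_toLp g q (volume : Measure (Space n))] with x hx
      rw [SchwartzMap.toLpCLM_apply, hx]
      rfl
  rw [sobolevNorm_eq hT hf, Lp.enorm_def]
  refine eLpNorm_le_of_forall_integral_mul_le (q := q) hp1 hp (Lp.memLp f) fun g hg => ?_
  have h5 := h2 (hg.toLp g)
  rw [Lp.enorm_def, eLpNorm_congr_ae hg.coeFn_toLp] at h5
  refine le_trans (le_of_eq ?_) h5
  congr 1
  refine integral_congr_ae ?_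
  filter_upwards [hg.coeFn_toLp] with x hx
  rw [hx]

end SobolevMultiplier

namespace SobolevMultiplier

/-! ### Localization of multipliers -/

variable {n : ℕ} {p : ℝ≥0∞} [Fact (1 ≤ p)] {a : ℝ}

theorem TestFn.toSchwartz_translate (φ : TestFn n) (z : Space n) :
    (φ.translate z).toSchwartz = φ.toSchwartz.compSubConstCLM ℂ z := rfl

theorem TestFn.toSchwartz_mulCLM (φ ψ : TestFn n) :
    (φ.mulCLM ψ).toSchwartz = smulSchwartz ψ.toSchwartz φ.toSchwartz := by
  ext x
  rw [smulSchwartz_apply]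
  rfl

theorem Distr.mul_mul (μ : Distr n) (φ ψ : TestFn n) :
    (μ.mul φ).mul ψ = μ.mul (φ.mulCLM ψ) := by
  ext h
  change μ (φ.mulCLM (ψ.mulCLM h)) = μ ((φ.mulCLM ψ).mulCLM h)
  congr 1
  ext x
  simp only [TestFn.mulCLM_apply, mul_assoc]

theorem MultiplierBound.multiplierNorm_le {μ : Distr n} {C : ℝ≥0} (h : MultiplierBound a p μ C) :
    multiplierNorm a p μ ≤ C :=
  iInf₂_le C h

theorem multiplierNorm_lt_top {μ : Distr n} (h : μ ∈ multiplierSpace n a p) :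
    multiplierNorm a p μ < ⊤ := by
  obtain ⟨-, C, hC⟩ := h
  exact hC.multiplierNorm_le.trans_lt ENNReal.coe_lt_top

/-- The infimum in the definition of the multiplier norm is attained. -/
theorem multiplierBound_multiplierNorm {μ : Distr n} (h : μ ∈ multiplierSpace n a p) :
    MultiplierBound a p μ (multiplierNorm a p μ).toNNReal := by
  intro φ
  rw [ENNReal.coe_toNNReal (multiplierNorm_lt_top h).ne]
  obtain ⟨-, C, hC⟩ := h
  rcases eq_or_ne (φ.sobolevNorm a p) 0 with h0 | h0
  · have := hC φ
    rw [h0, mul_zero] at this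
    exact this.trans zero_le
  · rw [← ENNReal.div_le_iff h0 φ.sobolevNorm_ne_top]
    refine le_iInf₂ fun D hD => ?_
    rw [ENNReal.div_le_iff h0 φ.sobolevNorm_ne_top]
    exact hD φ

theorem MultiplierBound.mono {μ : Distr n} {C D : ℝ≥0} (h : MultiplierBound a p μ C)
    (hCD : C ≤ D) : MultiplierBound a p μ D := fun φ => (h φ).trans (by gcongr)

theorem MemSobolevLoc.mul {μ : Distr n} (h : MemSobolevLoc a p μ) (φ : TestFn n) :
    MemSobolevLoc a p (μ.mul φ) := by
  intro ψ
  rw [Distr.mul_mul]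
  exact h _

/-- Multiplying a multiplier by the translates of a test function costs a factor that does not
depend on the translation. -/
theorem exists_multiplierBound_mul_translate (hp : p ≠ ⊤) (a : ℝ) (η : TestFn n) :
    ∃ K : ℝ≥0, ∀ (μ : Distr n) (C : ℝ≥0), MultiplierBound a p μ C → ∀ z,
      MultiplierBound a p (μ.mul (η.translate z)) (K * C) := by
  obtain ⟨K, hK⟩ := exists_bessel_translate_le (W := Space n) (q := p) Fact.out hp a η.toSchwartz
  refine ⟨K, fun μ C hC z φ => ?_⟩
  rw [Distr.mul_mul]
  refine (hC _).trans ?_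
  have h1 := hK z φ.toSchwartz
  rw [← TestFn.toSchwartz_translate, ← TestFn.toSchwartz_mulCLM, ← TestFn.sobolevNorm_eq,
    ← TestFn.sobolevNorm_eq] at h1
  calc _ ≤ (C : ℝ≥0∞) * (K * φ.sobolevNorm a p) := by gcongr
    _ = _ := by push_cast; ring

theorem sum_testFn_apply {ι : Type*} (S : Finset ι) (f : ι → TestFn n) (x : Space n) :
    (∑ i ∈ S, f i) x = ∑ i ∈ S, f i x := by
  classical
  induction S using Finset.induction_on with
  | empty => rfl
  | insert i S hi ih => rw [Finset.sum_insert hi, Finset.sum_insert hi, ← ih]; rfl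

/-- Inserting the partition of unity, and the function `η`, which equals one on the supports of its
members, decomposes a product into localized products. -/
theorem exists_apply_mul_eq_sum (hn : 1 ≤ n) {η : TestFn n} (hη : ∀ x, ‖x‖ ≤ 1 → η x = 1)
    (μ : Distr n) (φ h : TestFn n) :
    ∃ S : Finset (Fin n → ℤ), μ.mul φ h = ∑ z ∈ S,
      ((μ.mul (η.translate (latticePoint n z))).mul ((η.translate (latticePoint n z)).mulCLM φ))
        (((latticeBump n).translate (latticePoint n z)).mulCLM h) := by
  obtain ⟨r, hr⟩ := h.hasCompactSupport.isCompact.isBounded.subset_closedBall 0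
  obtain ⟨S, hS⟩ := exists_sum_latticeBump_eq_one hn r
  refine ⟨S, ?_⟩
  change μ (φ.mulCLM h) = ∑ z ∈ S, μ ((η.translate (latticePoint n z)).mulCLM
    (((η.translate (latticePoint n z)).mulCLM φ).mulCLM
      (((latticeBump n).translate (latticePoint n z)).mulCLM h)))
  rw [← map_sum]
  congr 1
  ext x
  rw [sum_testFn_apply]
  simp only [TestFn.mulCLM_apply]
  rcases eq_or_ne (h x) 0 with h0 | h0
  · simp [h0]
  have hx : ‖x‖ ≤ r := mem_closedBall_zero_iff.1 (hr (subset_tsupport _ h0))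
  have hterm (z : Fin n → ℤ) : h x * (latticeBump n).translate (latticePoint n z) x *
      (φ x * η.translate (latticePoint n z) x) * η.translate (latticePoint n z) x =
      h x * φ x * latticeBump n (x - latticePoint n z) := by
    change h x * latticeBump n (x - latticePoint n z) * (φ x * η (x - latticePoint n z)) *
      η (x - latticePoint n z) = _
    rcases eq_or_ne (latticeBump n (x - latticePoint n z)) 0 with h1 | h1
    · simp [h1]
    · rw [hη _ (mem_closedBall_zero_iff.1
        (tsupport_latticeBump_subset n (subset_tsupport _ h1)))]
      ring
  simp only [hterm]
  rw [← Finset.mul_sum, hS x hx, mul_one]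

/-- A uniform bound for the localizations of a distribution bounds the distribution: the localized
pairings are summed by Hölder's inequality in `ℓ^p` and `ℓ^q`. -/
theorem exists_multiplierBound_of_forall_mul_translate (hn : 1 ≤ n) (hp1 : 1 < p) (hp : p ≠ ⊤)
    (a : ℝ) {η : TestFn n} (hη : ∀ x, ‖x‖ ≤ 1 → η x = 1) :
    ∃ K : ℝ≥0, ∀ (μ : Distr n) (L : ℝ≥0), MemSobolevLoc (-a) p μ →
      (∀ z, MultiplierBound a p (μ.mul (η.translate z)) L) → MultiplierBound a p μ (K * L) := by
  set q := ENNReal.conjExponent p with hq_def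
  have hpq : p.HolderConjugate q := ENNReal.HolderConjugate.conjExponent hp1.le
  have hqp : q.HolderConjugate p := hpq.symm
  have hq1 : 1 ≤ q := ENNReal.HolderConjugate.one_le q p
  have : Fact (1 ≤ q) := ⟨hq1⟩
  have hq : q ≠ ⊤ := ((ENNReal.HolderConjugate.lt_top_iff_one_lt q p).2 hp1).ne
  obtain ⟨R, hR⟩ := η.hasCompactSupport.isCompact.isBounded.subset_closedBall 0
  obtain ⟨M, hM⟩ := exists_latticePoint_overlap hn R
  obtain ⟨M', hM'⟩ := exists_latticePoint_overlap hn 1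
  obtain ⟨A, hA⟩ := exists_sum_bessel_translate_le (χ := η.toSchwartz) hp1.le hp a hR hM
  obtain ⟨B, hB⟩ := exists_sum_bessel_translate_le (χ := (latticeBump n).toSchwartz) hq1 hq a
    (tsupport_latticeBump_subset n) hM'
  refine ⟨A * B, fun μ L hμ hL φ => ?_⟩
  have hN : ((φ.sobolevNorm a p).toNNReal : ℝ≥0∞) = φ.sobolevNorm a p :=
    ENNReal.coe_toNNReal φ.sobolevNorm_ne_top
  have key := sobolevNorm_le_of_forall_enorm_apply_le (q := q) hp1 hp (hμ φ)
    (K := A * B * L * (φ.sobolevNorm a p).toNNReal) fun h => ?_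
  · rw [ENNReal.coe_mul, hN] at key
    exact key
  obtain ⟨S, hS⟩ := exists_apply_mul_eq_sum hn hη μ φ h
  have h1 := hA S φ.toSchwartz
  have h2 := hB S h.toSchwartz
  rw [← TestFn.sobolevNorm_eq] at h1
  simp only [← TestFn.toSchwartz_translate, ← TestFn.toSchwartz_mulCLM] at h1 h2
  rw [hS]
  calc ‖_‖ₑ ≤ ∑ z ∈ S, L * (eLpNorm (bessel ℂ a
          ((η.translate (latticePoint n z)).mulCLM φ).toSchwartz) p volume *
        eLpNorm (bessel ℂ a
          (((latticeBump n).translate (latticePoint n z)).mulCLM h).toSchwartz) q volume) := by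
        refine (enorm_sum_le _ _).trans (Finset.sum_le_sum fun z _ => ?_)
        refine (enorm_apply_le_sobolevNorm_mul (q := q) (hμ.mul _ _) _).trans ?_
        rw [← mul_assoc, ← TestFn.sobolevNorm_eq (p := p)]
        gcongr
        exact hL _ _
    _ ≤ L * ((A * φ.sobolevNorm a p) * (B * eLpNorm (bessel ℂ a h.toSchwartz) q volume)) := by
        rw [← Finset.mul_sum]
        gcongr
        refine (ENNReal.inner_le_Lp_mul_Lq S _ _
          (ENNReal.HolderConjugate.toReal_of_ne_top hp hq)).trans ?_
        gcongr
    _ = _ := by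
        simp only [ENNReal.coe_mul, hN]
        ring

end SobolevMultiplier

end

theorem mainTheorem7 (n : ℕ) (hn : 1 ≤ n) (α : ℝ) (p : ℝ≥0∞) [Fact (1 ≤ p)] (hp1 : 1 < p)
    (hp : p < ⊤) (η : SobolevMultiplier.TestFn n)
    (hη_nonneg : ∀ x, 0 ≤ (η x).re ∧ (η x).im = 0)
    (hη_one : ∀ x, ‖x‖ ≤ 1 → η x = 1) :
    ∃ C : ℝ≥0, 0 < C ∧ ∀ μ ∈ SobolevMultiplier.multiplierSpace n α p,
      (∀ z, μ.mul (η.translate z) ∈ SobolevMultiplier.multiplierSpace n α p) ∧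
      SobolevMultiplier.multiplierNorm α p μ < ⊤ ∧
      SobolevMultiplier.localizedNorm η α p μ < ⊤ ∧
      SobolevMultiplier.localizedNorm η α p μ ≤ C * SobolevMultiplier.multiplierNorm α p μ ∧
      SobolevMultiplier.multiplierNorm α p μ ≤ C * SobolevMultiplier.localizedNorm η α p μ := by
  obtain ⟨K₁, hK₁⟩ := SobolevMultiplier.exists_multiplierBound_mul_translate hp.ne α η
  obtain ⟨K₂, hK₂⟩ :=
    SobolevMultiplier.exists_multiplierBound_of_forall_mul_translate hn hp1 hp.ne α hη_one
  refine ⟨K₁ + K₂ + 1, by positivity, fun μ hμ => ?_⟩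
  have hb := SobolevMultiplier.multiplierBound_multiplierNorm hμ
  have htop := SobolevMultiplier.multiplierNorm_lt_top hμ
  have hz (z) := hK₁ μ _ hb z
  have hmem (z) : μ.mul (η.translate z) ∈ SobolevMultiplier.multiplierSpace n α p :=
    ⟨hμ.1.mul _, _, hz z⟩
  have hloc : SobolevMultiplier.localizedNorm η α p μ ≤
      K₁ * SobolevMultiplier.multiplierNorm α p μ := by
    refine iSup_le fun z => (hz z).multiplierNorm_le.trans_eq ?_
    rw [ENNReal.coe_mul, ENNReal.coe_toNNReal htop.ne]
  have hloctop : SobolevMultiplier.localizedNorm η α p μ < ⊤ :=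
    hloc.trans_lt (ENNReal.mul_lt_top ENNReal.coe_lt_top htop)
  refine ⟨hmem, htop, hloctop, hloc.trans ?_, ?_⟩
  · gcongr
    exact le_add_right (le_add_right le_rfl)
  · have h1 := hK₂ μ (SobolevMultiplier.localizedNorm η α p μ).toNNReal hμ.1 fun z =>
      (SobolevMultiplier.multiplierBound_multiplierNorm (hmem z)).mono
        (ENNReal.toNNReal_mono hloctop.ne
          (le_iSup (fun z => SobolevMultiplier.multiplierNorm α p (μ.mul (η.translate z))) z))
    refine h1.multiplierNorm_le.trans ?_
    rw [ENNReal.coe_mul, ENNReal.coe_toNNReal hloctop.ne]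
    gcongr
    exact le_add_right le_add_self
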